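/- Let $k$ be a field, let $V$ be a $k$-vector space of finite dimension with basis $(x_1,\ldots,x_n)$, and let $f=\sum_{1\le i,j\le n} f_{ij}\,x_i\otimes x_j\in V\otimes V$ with matrix of coefficients $M=(f_{ij})$. Let $R=k\cdot f$ and let $A=T(V)/(f)$ be the graded $k$-algebra generated by $V$ in degree $1$ subject to the single quadratic relation $f=0$. The rank of $f$ is the rank of $M$ (it does not depend on the basis). Assume that the rank of $f$ is $>1$. Then (i) every nonzero element of $V$ is neither a left nor a right zero divisor in $A$; (ii) the global dimension of $A$ is $2$; (iii) $A$ is Koszul, i.e. the Koszul complex of left $A$-modules $\cdots\to A\otimes W_2\to A\otimes W_1\to A\otimes W_0\to 0$, where $W_m=\bigcap_{i+2+j=m}V^{\otimes i}\otimes R\otimes V^{\otimes j}\subseteq V^{\otimes m}$ (so $W_0=k$, $W_1=V$) and the differential sends $a\otimes v_1\cdots v_m$ to $av_1\otimes v_2\cdots v_m$, has zero homology in every degree $>0$; (iv) $A$ is AS-Gorenstein if and only if $M$ is invertible. Here a connected graded algebra $A$ is AS-Gorenstein if it has finite global dimension $d\ge 1$, $\mathrm{Ext}^i_A(k,A)=0$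 for $i\ne d$, and $\mathrm{Ext}^d_A(k,A)\cong k$ as right $A$-modules, where $\mathrm{Ext}$ is taken over left modules. -/

import Mathlib

open TensorProduct CategoryTheory

universe u v w

noncomputable section

namespace QuadraticAlgebraOneRelation

/-! ### Left-concatenation in the tensor algebra -/

section TensorAlgebra

variable (k : Type u) (V : Type v) [Field k] [AddCommGroup V] [Module k V]

/-- The embedding `V ⊗ V → T(V)`, `v ⊗ w ↦ v w`, onto the elements of degree two. -/
def sqMap : V ⊗[k] V →ₗ[k] TensorAlgebra k V :=
  TensorProduct.lift
    ((LinearMap.mul k (TensorAlgebra k V)).compl₁₂ (TensorAlgebra.ι k) (TensorAlgebra.ι k))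

@[simp] theorem sqMap_tmul (x y : V) :
    sqMap k V (x ⊗ₜ y) = TensorAlgebra.ι k x * TensorAlgebra.ι k y := rfl

/-- `V^{⊗ m}` inside `T(V)`. -/
abbrev tpow (m : ℕ) : Submodule k (TensorAlgebra k V) :=
  LinearMap.range (TensorAlgebra.ι k : V →ₗ[k] TensorAlgebra k V) ^ m

/-- Auxiliary: the action of `T(V)` on `T(V) × (V ⊗ T(V))` in which `v` sends `(t, s)` to
`(v t, v ⊗ t)`. -/
def splitAction :
    TensorAlgebra k V →ₐ[k]
      Module.End k (TensorAlgebra k V × (V ⊗[k] TensorAlgebra k V)) :=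
  TensorAlgebra.lift k
    { toFun := fun x =>
        ((LinearMap.mulLeft k (TensorAlgebra.ι k x)).prod
          (TensorProduct.mk k V (TensorAlgebra k V) x)).comp
            (LinearMap.fst k (TensorAlgebra k V) (V ⊗[k] TensorAlgebra k V))
      map_add' := fun x y => by
        refine LinearMap.ext fun p => ?_
        simp [add_mul]
      map_smul' := fun c x => by
        refine LinearMap.ext fun p => ?_
        simp [TensorProduct.smul_tmul'] }

/-- The linear map `T(V) → V ⊗ T(V)` with `1 ↦ 0` and `v t ↦ v ⊗ t` for `v ∈ V`, `t ∈ T(V)`;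
it identifies `V^{⊗ (m+1)}` with `V ⊗ V^{⊗ m}`. -/
def leftSplit : TensorAlgebra k V →ₗ[k] V ⊗[k] TensorAlgebra k V where
  toFun t := (splitAction k V t (1, 0)).2
  map_add' s t := by simp
  map_smul' c t := by simp

theorem splitAction_fst (t : TensorAlgebra k V)
    (p : TensorAlgebra k V × (V ⊗[k] TensorAlgebra k V)) :
    (splitAction k V t p).1 = t * p.1 := by
  induction t using TensorAlgebra.induction generalizing p with
  | algebraMap r => simp [Algebra.smul_def]
  | ι x => simp [splitAction]
  | mul a b ha hb => rw [map_mul, Module.End.mul_apply, ha, hb, mul_assoc]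
  | add a b ha hb => simp [ha, hb, add_mul]

theorem leftSplit_one : leftSplit k V 1 = 0 := by simp [leftSplit]

theorem leftSplit_ι_mul (x : V) (t : TensorAlgebra k V) :
    leftSplit k V (TensorAlgebra.ι k x * t) = x ⊗ₜ t := by
  have h := splitAction_fst k V t (1, 0)
  simp only [mul_one] at h
  simp only [leftSplit, LinearMap.coe_mk, AddHom.coe_mk, map_mul, Module.End.mul_apply]
  have key : ∀ p : TensorAlgebra k V × (V ⊗[k] TensorAlgebra k V),
      (splitAction k V (TensorAlgebra.ι k x) p).2 = x ⊗ₜ p.1 := fun p => by simp [splitAction]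
  rw [key, h]

/-- The left partial derivative `T(V) → T(V)` along a linear form `ξ` on `V`:
`1 ↦ 0` and `v t ↦ ξ(v) t`. -/
def leftDeriv (ξ : V →ₗ[k] k) : TensorAlgebra k V →ₗ[k] TensorAlgebra k V :=
  (TensorProduct.lid k (TensorAlgebra k V)).toLinearMap.comp
    ((ξ.rTensor (TensorAlgebra k V)).comp (leftSplit k V))

theorem leftDeriv_mem (ξ : V →ₗ[k] k) (X : Submodule k (TensorAlgebra k V))
    {w : TensorAlgebra k V}
    (hw : w ∈ LinearMap.range (TensorAlgebra.ι k : V →ₗ[k] TensorAlgebra k V) * X) :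
    leftDeriv k V ξ w ∈ X := by
  induction hw using Submodule.mul_induction_on' with
  | mem_mul_mem a ha t ht =>
    obtain ⟨x, rfl⟩ := ha
    simpa [leftDeriv, leftSplit_ι_mul] using X.smul_mem (ξ x) ht
  | add a _ b _ ha hb => rw [map_add]; exact X.add_mem ha hb

end TensorAlgebra

/-! ### Quadratic algebras and their Koszul complexes -/

section Quadratic

variable {k : Type u} {V : Type v} [Field k] [AddCommGroup V] [Module k V]
variable (R : Submodule k (V ⊗[k] V))

/-- The relations `r = 0`, `r ∈ R`, in `T(V)`. -/
def quadRel (a b : TensorAlgebra k V) : Prop := a ∈ R.map (sqMap k V) ∧ b = 0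

/-- The quadratic algebra `A(V, R) = T(V) / I(R)`, where `I(R)` is the two-sided ideal
generated by the space of relations `R ⊆ V ⊗ V`. -/
abbrev QuadAlg : Type (max u v) := RingQuot (quadRel R)

/-- The canonical map `V → A(V, R)`. -/
def generator : V →ₗ[k] QuadAlg R :=
  (RingQuot.mkAlgHom k (quadRel R)).toLinearMap.comp (TensorAlgebra.ι k)

/-- The augmentation `A(V, R) → k` of the connected graded algebra `A(V, R)`, i.e. the
algebra morphism which vanishes on `V`. -/
def augmentation : QuadAlg R →ₐ[k] k :=
  RingQuot.liftAlgHom k ⟨TensorAlgebra.algebraMapInv, by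
    rintro a b ⟨⟨r, -, rfl⟩, rfl⟩
    rw [map_zero]
    induction r using TensorProduct.induction_on with
    | zero => simp
    | tmul x y => simp [TensorAlgebra.algebraMapInv]
    | add x y hx hy => rw [map_add, map_add, hx, hy, add_zero]⟩

/-- The subspace `W_m = ⋂_{i + 2 + j = m} V^{⊗ i} ⊗ R ⊗ V^{⊗ j}` of `V^{⊗ m}`
(so `W_0 = k`, `W_1 = V`, `W_2 = R`). -/
def koszulW (m : ℕ) : Submodule k (TensorAlgebra k V) :=
  tpow k V m ⊓
    ⨅ (i : ℕ) (j : ℕ) (_ : i + 2 + j = m), tpow k V i * R.map (sqMap k V) * tpow k V j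

/-- The `A`-linear map `A ⊗ T(V) → A ⊗ T(V)` with `a ⊗ v t ↦ a v ⊗ t` for `v ∈ V` and
`a ⊗ 1 ↦ 0`. -/
def koszulMap :
    QuadAlg R ⊗[k] TensorAlgebra k V →ₗ[QuadAlg R] QuadAlg R ⊗[k] TensorAlgebra k V :=
  TensorProduct.AlgebraTensorModule.lift <|
    LinearMap.toSpanSingleton (QuadAlg R)
      (TensorAlgebra k V →ₗ[k] QuadAlg R ⊗[k] TensorAlgebra k V)
      (((generator R).rTensor (TensorAlgebra k V)).comp (leftSplit k V))

theorem koszulMap_tmul_ι_mul (a : QuadAlg R) (x : V) (t : TensorAlgebra k V) :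
    koszulMap R (a ⊗ₜ (TensorAlgebra.ι k x * t)) = (a * generator R x) ⊗ₜ t := by
  simp [koszulMap, leftSplit_ι_mul, TensorProduct.smul_tmul']

theorem koszulMap_tmul_one (a : QuadAlg R) :
    koszulMap R (a ⊗ₜ (1 : TensorAlgebra k V)) = 0 := by
  simp [koszulMap, leftSplit_one]

/-- The inclusion `A ⊗ W_m → A ⊗ T(V)`. -/
def koszulIncl (m : ℕ) :
    QuadAlg R ⊗[k] koszulW R m →ₗ[QuadAlg R] QuadAlg R ⊗[k] TensorAlgebra k V :=
  TensorProduct.AlgebraTensorModule.lTensor (QuadAlg R) (QuadAlg R) (koszulW R m).subtype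

theorem koszulIncl_injective (m : ℕ) : Function.Injective (koszulIncl R m) :=
  Module.Flat.lTensor_preserves_injective_linearMap (koszulW R m).subtype
    (koszulW R m).injective_subtype

/-- The `m`-th term `K_m = A ⊗ W_m` of the Koszul complex, realised inside `A ⊗ T(V)`. -/
def koszulX (m : ℕ) : Submodule (QuadAlg R) (QuadAlg R ⊗[k] TensorAlgebra k V) :=
  LinearMap.range (koszulIncl R m)

/-- `K_m` is (isomorphic to) `A ⊗ W_m`. -/
def koszulXEquiv (m : ℕ) : (QuadAlg R ⊗[k] koszulW R m) ≃ₗ[QuadAlg R] koszulX R m :=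
  LinearEquiv.ofInjective (koszulIncl R m) (koszulIncl_injective R m)

theorem leftDeriv_mem_koszulW (ξ : V →ₗ[k] k) {m : ℕ} {w : TensorAlgebra k V} (hw : w ∈ koszulW R (m + 1)) :
    leftDeriv k V ξ w ∈ koszulW R m := by
  obtain ⟨h1, h2⟩ := Submodule.mem_inf.1 hw
  refine Submodule.mem_inf.2 ⟨leftDeriv_mem k V ξ _ ?_, ?_⟩
  · rwa [← pow_succ']
  · simp only [Submodule.mem_iInf] at h2 ⊢
    intro i j hij
    refine leftDeriv_mem k V ξ _ ?_
    have := h2 (i + 1) j (by omega)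
    rwa [tpow, pow_succ', mul_assoc, mul_assoc, ← mul_assoc (_ ^ i)] at this

theorem koszulMap_mem {m : ℕ} {z : QuadAlg R ⊗[k] TensorAlgebra k V}
    (hz : z ∈ koszulX R (m + 1)) : koszulMap R z ∈ koszulX R m := by
  obtain ⟨y, rfl⟩ := hz
  induction y using TensorProduct.induction_on with
  | zero => simp
  | add x y hx hy => rw [map_add, map_add]; exact (koszulX R m).add_mem hx hy
  | tmul a w =>
    classical
    let b := Module.Basis.ofVectorSpace k V
    have hs : leftSplit k V (w : TensorAlgebra k V) =
        (TensorProduct.equivFinsuppOfBasisLeft b (leftSplit k V w)).sum fun i n => b i ⊗ₜ n := by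
      rw [← TensorProduct.equivFinsuppOfBasisLeft_symm_apply, LinearEquiv.symm_apply_apply]
    have e : koszulMap R (koszulIncl R (m + 1) (a ⊗ₜ w)) =
        a • (generator R).rTensor (TensorAlgebra k V) (leftSplit k V (w : TensorAlgebra k V)) := rfl
    rw [e, hs]
    refine Submodule.smul_mem _ _ ?_
    rw [Finsupp.sum, map_sum]
    refine Submodule.sum_mem _ fun i _ => ?_
    rw [TensorProduct.equivFinsuppOfBasisLeft_apply]
    exact ⟨generator R (b i) ⊗ₜ ⟨_, leftDeriv_mem_koszulW R (b.coord i) w.2⟩, rfl⟩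

/-- The differential `K_{m+1} → K_m` of the Koszul complex of left `A`-modules
`⋯ → A ⊗ W_2 → A ⊗ W_1 → A ⊗ W_0 → 0`; it sends `a ⊗ v t` to `a v ⊗ t`. -/
def koszulD (m : ℕ) : koszulX R (m + 1) →ₗ[QuadAlg R] koszulX R m :=
  (koszulMap R).restrict fun _ hz => koszulMap_mem R hz

/-- In the Koszul complex the composition of two consecutive differentials vanishes. -/
theorem koszulD_comp (m : ℕ) (z : koszulX R (m + 2)) : koszulD R m (koszulD R (m + 1) z) = 0 := by
  have hR : ∀ (a : QuadAlg R) (r : V ⊗[k] V) (t : TensorAlgebra k V),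
      koszulMap R (koszulMap R (a ⊗ₜ (sqMap k V r * t))) =
        (a * RingQuot.mkAlgHom k (quadRel R) (sqMap k V r)) ⊗ₜ t := by
    intro a r t
    induction r using TensorProduct.induction_on with
    | zero => simp
    | add x y hx hy => simp only [map_add, add_mul, mul_add, TensorProduct.tmul_add,
        TensorProduct.add_tmul, hx, hy]
    | tmul x y =>
      rw [sqMap_tmul, mul_assoc, koszulMap_tmul_ι_mul, koszulMap_tmul_ι_mul, map_mul, mul_assoc]
      rfl
  have hz0 : ∀ w ∈ R.map (sqMap k V) * tpow k V m, ∀ a : QuadAlg R,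
      koszulMap R (koszulMap R (a ⊗ₜ w)) = 0 := by
    intro w hw a
    induction hw using Submodule.mul_induction_on' with
    | mem_mul_mem s hs t ht =>
      obtain ⟨r, hr, rfl⟩ := hs
      have h0 : RingQuot.mkAlgHom k (quadRel R) (sqMap k V r) = 0 := by
        rw [RingQuot.mkAlgHom_rel k (show quadRel R (sqMap k V r) 0 from ⟨⟨r, hr, rfl⟩, rfl⟩),
          map_zero]
      rw [hR, h0, mul_zero, TensorProduct.zero_tmul]
    | add x _ y _ hx hy => rw [TensorProduct.tmul_add, map_add, map_add, hx, hy, add_zero]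
  obtain ⟨z, y, rfl⟩ := z
  refine Subtype.ext ?_
  change koszulMap R (koszulMap R (koszulIncl R (m + 2) y)) = 0
  induction y using TensorProduct.induction_on with
  | zero => simp
  | add x y hx hy => rw [map_add, map_add, map_add, hx, hy, add_zero]
  | tmul a w =>
    refine hz0 w ?_ a
    have h := (Submodule.mem_inf.1 w.2).2
    simp only [Submodule.mem_iInf] at h
    simpa [tpow] using h 0 m (by omega)

/-- `A(V, R)` is Koszul: the homology of its Koszul complex vanishes in every degree `> 0`. -/
def IsKoszul : Prop :=
  ∀ m : ℕ, Function.Exact (koszulD R (m + 1)) (koszulD R m)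

end Quadratic

/-! ### Global dimension and the AS-Gorenstein property -/

section Homological

/-- The (left) global dimension of a ring: the supremum of the projective dimensions of its
left modules. -/
def globalDimension (A : Type w) [Ring A] : WithBot ℕ∞ :=
  ⨆ M : ModuleCat.{w} A, projectiveDimension M

variable {k : Type u} {A : Type w} [Field k] [Ring A] [Algebra k A]

/-- The trivial left module `k = A / ker ε` of an augmented algebra `ε : A → k`. -/
abbrev trivialModule (ε : A →ₐ[k] k) : ModuleCat.{w} A := ModuleCat.of A (A ⧸ RingHom.ker ε)

/-- Right multiplication `x ↦ x a`, an endomorphism of the left module `A`. -/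
abbrev rightMul (a : A) : ModuleCat.of A A ⟶ ModuleCat.of A A :=
  ModuleCat.ofHom (LinearMap.toSpanSingleton A A a)

/-- A connected graded algebra `A` with augmentation `ε : A → k` is AS-Gorenstein if it has finite
global dimension `n ≥ 1`, `Ext^i_A(k, A) = 0` for `i ≠ n`, and `Ext^n_A(k, A) ≅ k` as right
`A`-modules. Here `Ext` is taken over left modules, `a ∈ A` acts on the right of `Ext^n_A(k, A)`
through the endomorphism `x ↦ x a` of the left module `A`, and on the right of `k` through
multiplication by `ε a`. -/
def IsASGorenstein (ε : A →ₐ[k] k) : Prop :=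
  ∃ n : ℕ, 1 ≤ n ∧ globalDimension A = n ∧
    (∀ i : ℕ, i ≠ n → Subsingleton (Abelian.Ext (trivialModule ε) (ModuleCat.of A A) i)) ∧
    ∃ φ : Abelian.Ext (trivialModule ε) (ModuleCat.of A A) n ≃+ k,
      ∀ (e : Abelian.Ext (trivialModule ε) (ModuleCat.of A A) n) (a : A),
        φ (e.comp (Abelian.Ext.mk₀ (rightMul a)) (add_zero n)) = φ e * ε a

end Homological

/-- The matrix of coefficients `(f_{ij})` of `f = ∑ f_{ij} x_i ⊗ x_j` relative to a basis `x`. -/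
def coeffMatrix {k : Type u} {V : Type v} [Field k] [AddCommGroup V] [Module k V] {n : ℕ}
    (x : Module.Basis (Fin n) k V) (f : V ⊗[k] V) : Matrix (Fin n) (Fin n) k :=
  fun i j => (x.tensorProduct x).repr f (i, j)

theorem sum_coeffMatrix {k : Type u} {V : Type v} [Field k] [AddCommGroup V] [Module k V] {n : ℕ}
    (x : Module.Basis (Fin n) k V) (f : V ⊗[k] V) :
    ∑ i, ∑ j, coeffMatrix x f i j • (x i ⊗ₜ[k] x j) = f := by
  conv_rhs => rw [← (x.tensorProduct x).sum_repr f]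
  rw [Fintype.sum_prod_type]
  simp [coeffMatrix]

end QuadraticAlgebraOneRelation

end

open QuadraticAlgebraOneRelation

/-! Write g_j and h_i for the linear forms given by column j and row i of the matrix c, so that the
relation reads ∑ g_j X_j = 0 = ∑ X_i h_i. Everything rests on two facts about A.

Linear syzygies: if ∑ X_i a_i = 0, then a_i = h_i b for a single b (`exists_eq_lin_mul`), and
symmetrically ∑ a_j X_j = 0 forces a_j = b g_j. This needs no rank hypothesis and no normal form:
the universal property of A is applied to endomorphisms of a module built so that the action of ∑
X_i a_i displays the class of (a_i) modulo the expected syzygies.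

Zero divisors: when the rank exceeds 1, nonzero linear forms are regular. If a l = 0, the syzygy
statement gives a = b m with m linear and b killing another nonzero linear form; the degree drops by
one each time, so every homogeneous component of a vanishes (`eq_zero_of_mul_lin`).

Consequently 0 → A → Aⁿ → A → k → 0 is a free resolution, which is also the Koszul complex, since
W_m = 0 for m ≥ 3 (`koszulW_three_eq_bot`). The bimodule version of this resolution, tensored with a
module N, resolves N in length two, so the global dimension is at most 2. Dualising the resolution
of k gives Ext²(k, A) = A / ∑ g_j A. This is never zero, whence equality, and it is k exactly when
the g_j span all linear forms, that is, when c is invertible; in that case Ext¹(k, A) also vanishes.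
-/

namespace QuadraticAlgebraOneRelation

/-- `A` is the `k`-algebra generated by `X 0, …, X (n - 1)` subject to the single relation
`∑ c i j • X i * X j = 0`. -/
structure IsOneRelator {k : Type u} {A : Type w} [Field k] [Ring A] [Algebra k A] {n : ℕ}
    (c : Matrix (Fin n) (Fin n) k) (X : Fin n → A) : Prop where
  rel : ∑ i, ∑ j, c i j • (X i * X j) = 0
  lift : ∀ (B : Type w) [Ring B] [Algebra k B] (y : Fin n → B),
    ∑ i, ∑ j, c i j • (y i * y j) = 0 → ∃ φ : A →ₐ[k] B, ∀ i, φ (X i) = y i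
  adjoin : Algebra.adjoin k (Set.range X) = ⊤

/-! ### Linear forms in the generators and their syzygies. -/

section Lin

variable {k : Type u} {A : Type w} [Field k] [Ring A] [Algebra k A] {n : ℕ}

/-- The linear combination `∑ l i • X i`. -/
def lin (X : Fin n → A) (l : Fin n → k) : A := ∑ i, l i • X i

theorem lin_sum_smul (X : Fin n → A) (M : Matrix (Fin n) (Fin n) k) (l : Fin n → k) :
    lin X (M.mulVec l) = ∑ j, l j • lin X (fun i => M i j) := by
  simp only [lin, Matrix.mulVec, dotProduct, Finset.sum_smul, Finset.smul_sum]
  rw [Finset.sum_comm]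
  simp only [smul_smul, mul_comm]

theorem map_lin {B : Type*} [Ring B] [Algebra k B] (φ : A →ₐ[k] B) (X : Fin n → A)
    (l : Fin n → k) : φ (lin X l) = lin (fun i => φ (X i)) l := by
  simp [lin]

end Lin

namespace IsOneRelator

variable {k : Type u} {A : Type w} [Field k] [Ring A] [Algebra k A] {n : ℕ}
  {c : Matrix (Fin n) (Fin n) k} {X : Fin n → A}

theorem rel_right (hA : IsOneRelator c X) : ∑ j, lin X (fun i => c i j) * X j = 0 := by
  rw [← hA.rel, Finset.sum_comm]
  simp [lin, Finset.sum_mul]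

theorem rel_left (hA : IsOneRelator c X) : ∑ i, X i * lin X (c i) = 0 := by
  rw [← hA.rel]
  simp [lin, Finset.mul_sum]

/-- Words are built from 1 by left multiplications. The strengthened claim that `P b` implies `P (a
* b)` is stable under products in `a`, which the bare predicate need not be. -/
theorem induction_mul_left (hA : IsOneRelator c X) {P : A → Prop} (one : P 1)
    (add : ∀ a b, P a → P b → P (a + b)) (smul : ∀ (r : k) a, P a → P (r • a))
    (mul : ∀ i a, P a → P (X i * a)) (a : A) : P a := by
  have key : ∀ b, P b → P (a * b) := by
    have ha : a ∈ Algebra.adjoin k (Set.range X) := by rw [hA.adjoin]; trivial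
    induction ha using Algebra.adjoin_induction with
    | mem a ha => obtain ⟨i, rfl⟩ := ha; exact mul i
    | algebraMap r => intro b hb; rw [← Algebra.smul_def]; exact smul r b hb
    | add a b _ _ ha hb => intro c hc; rw [add_mul]; exact add _ _ (ha c hc) (hb c hc)
    | mul a b _ _ ha hb => intro c hc; rw [mul_assoc]; exact ha _ (hb c hc)
  simpa using key 1 one

/-- The hypothesis is left-right symmetric up to transposing c, so each one-sided statement yields
its mirror image. -/
theorem op (hA : IsOneRelator c X) :
    IsOneRelator c.transpose (fun i => MulOpposite.op (X i)) where
  rel := by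
    have := congrArg MulOpposite.op hA.rel
    rw [Finset.sum_comm] at this
    simpa [Finset.op_sum] using this
  lift B _ _ y hy := by
    obtain ⟨φ, hφ⟩ := hA.lift Bᵐᵒᵖ (fun i => MulOpposite.op (y i)) (by
      have := congrArg MulOpposite.op hy
      rw [Finset.sum_comm] at this
      simpa [Finset.op_sum] using this)
    refine ⟨(AlgEquiv.opOp k B).symm.toAlgHom.comp (AlgHom.op φ), fun i => ?_⟩
    simp [hφ]
  adjoin := by
    refine eq_top_iff.2 fun a _ => ?_
    obtain ⟨a, rfl⟩ := MulOpposite.op_surjective a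
    have ha : a ∈ Algebra.adjoin k (Set.range X) := by rw [hA.adjoin]; trivial
    induction ha using Algebra.adjoin_induction with
    | mem a ha => obtain ⟨i, rfl⟩ := ha; exact Algebra.subset_adjoin ⟨i, rfl⟩
    | algebraMap r => exact Subalgebra.algebraMap_mem _ r
    | add a b _ _ ha hb => rw [MulOpposite.op_add]; exact add_mem (ha trivial) (hb trivial)
    | mul a b _ _ ha hb => rw [MulOpposite.op_mul]; exact mul_mem (hb trivial) (ha trivial)

/-- Exactness of `A → Aⁿ → A`, `b ↦ (h_i b)_i`, `(a_i) ↦ ∑ X i * a i`. -/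
theorem exists_eq_lin_mul (hA : IsOneRelator c X) {a : Fin n → A} (ha : ∑ i, X i * a i = 0) :
    ∃ b, ∀ i, a i = lin X (c i) * b := by
  let S : Submodule k (Fin n → A) :=
    LinearMap.range (LinearMap.pi fun i => LinearMap.mulLeft k (lin X (c i)))
  -- The generator X_i sends (p, q) to (X_i p, [p e_i]), recording which letter was applied last.
  -- The relation then acts in the second coordinate by [(h_i p)_i], which is zero modulo S.
  let y : Fin n → Module.End k (A × ((Fin n → A) ⧸ S)) := fun i =>
    ((LinearMap.mulLeft k (X i)).prod
      (S.mkQ ∘ₗ LinearMap.single k (fun _ : Fin n => A) i)) ∘ₗ LinearMap.fst k A _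
  have hy : ∀ i p, y i p = (X i * p.1, S.mkQ (Pi.single i p.1)) := fun i p => rfl
  obtain ⟨φ, hφ⟩ := hA.lift _ y (by
    refine LinearMap.ext fun p => ?_
    simp only [LinearMap.sum_apply, LinearMap.smul_apply, Module.End.mul_apply, hy,
      LinearMap.zero_apply, Prod.smul_mk]
    refine Prod.ext ?_ ?_
    · simp only [Prod.fst_sum, Prod.fst_zero]
      have := congrArg (· * p.1) hA.rel
      simpa [Finset.sum_mul, mul_assoc] using this
    · simp only [Prod.snd_sum, Prod.snd_zero, ← map_smul, ← map_sum]
      refine (Submodule.Quotient.mk_eq_zero S).2 ⟨p.1, funext fun i => ?_⟩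
      simp [lin, Finset.sum_apply, Pi.single_apply, Finset.sum_mul])
  have h1 : ∀ a p, (φ a p).1 = a * p.1 := by
    intro a
    induction a using hA.induction_mul_left with
    | one => simp
    | add a b ha hb => intro p; simp [ha, hb, add_mul]
    | smul r a ha => intro p; simp [ha]
    | mul i a ha => intro p; simp [hφ, hy, ha, mul_assoc]
  -- Evaluated at (1, 0), this sum has second coordinate [(a_i)_i], so its vanishing puts the tuple
  -- in S.
  have h2 : ∑ i, φ (X i * a i) (1, 0) = 0 := by
    rw [← LinearMap.sum_apply, ← map_sum, ha]; simp
  have h3 : S.mkQ a = 0 := by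
    have h := congrArg Prod.snd h2
    simp only [Prod.snd_sum, map_mul, hφ, Module.End.mul_apply, hy, h1, mul_one, ← map_sum,
      Finset.univ_sum_single, Prod.snd_zero] at h
    exact h
  obtain ⟨b, hb⟩ := (Submodule.Quotient.mk_eq_zero S).1 h3
  exact ⟨b, fun i => by rw [← hb]; rfl⟩

/-- Exactness of `A → Aⁿ → A`, `b ↦ (b g_j)_j`, `(a_j) ↦ ∑ a j * X j`. -/
theorem exists_eq_mul_lin (hA : IsOneRelator c X) {a : Fin n → A} (ha : ∑ j, a j * X j = 0) :
    ∃ b, ∀ j, a j = b * lin X (fun i => c i j) := by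
  obtain ⟨b, hb⟩ := hA.op.exists_eq_lin_mul (a := fun j => MulOpposite.op (a j)) (by
    have := congrArg MulOpposite.op ha
    simpa [Finset.op_sum] using this)
  refine ⟨b.unop, fun j => MulOpposite.op_injective ?_⟩
  rw [hb]
  simp only [lin, MulOpposite.op_mul, Finset.op_sum, MulOpposite.op_unop, MulOpposite.op_smul,
    Matrix.transpose_apply]

/-- A scalar dependence is a syzygy with constant entries. It must have the form h_i b, and ε kills
each h_i. -/
theorem linearIndependent (hA : IsOneRelator c X) (ε : A →ₐ[k] k) (hε : ∀ i, ε (X i) = 0)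
    {l : Fin n → k} (hl : lin X l = 0) : l = 0 := by
  obtain ⟨b, hb⟩ := hA.exists_eq_lin_mul (a := fun i => algebraMap k A (l i)) (by
    rw [← hl, lin]
    exact Finset.sum_congr rfl fun i _ => by rw [← Algebra.commutes, Algebra.smul_def])
  funext i
  have := congrArg ε (hb i)
  simpa [map_lin, lin, hε] using this

/-! ### Grading and regularity of linear forms. -/

/-- The grading of `A`, recorded by the algebra morphism `A → A[t]`, `X i ↦ X i * t`. -/
theorem exists_grading (hA : IsOneRelator c X) :
    ∃ φ : A →ₐ[k] Polynomial A,
      (∀ l : Fin n → k, φ (lin X l) = Polynomial.C (lin X l) * Polynomial.X) ∧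
      ∀ a : A, Polynomial.eval 1 (φ a) = a := by
  obtain ⟨φ, hφ⟩ := hA.lift (Polynomial A) (fun i => Polynomial.C (X i) * Polynomial.X) (by
    have h : ∀ i j, (Polynomial.C (X i) * Polynomial.X) * (Polynomial.C (X j) * Polynomial.X) =
        Polynomial.C (X i * X j) * Polynomial.X ^ 2 := fun i j => by
      rw [mul_assoc, ← mul_assoc Polynomial.X, Polynomial.X_mul_C, map_mul]
      simp only [mul_assoc, sq]
    simp only [h, ← smul_mul_assoc, ← Finset.sum_mul, Polynomial.smul_C]
    have h0 := congrArg (Polynomial.C : A → Polynomial A) hA.rel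
    simp only [map_sum, map_zero, ← smul_mul_assoc] at h0
    rw [h0, zero_mul])
  refine ⟨φ, fun l => ?_, fun a => ?_⟩
  · rw [map_lin, lin, lin, map_sum, Finset.sum_mul]
    simp only [hφ, ← smul_mul_assoc, Polynomial.smul_C]
  · induction a using hA.induction_mul_left with
    | one => simp
    | add a b ha hb => simp [ha, hb]
    | smul r a ha => rw [map_smul, Polynomial.eval_smul, ha]
    | mul i a ha =>
      rw [map_mul, hφ, mul_assoc, Polynomial.eval_C_mul, Polynomial.X_mul, Polynomial.eval_mul_X,
        ha, mul_one]

/-- Over a matrix of rank `> 1` the kernel of a linear form does not lie in the kernel. -/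
theorem exists_mulVec_ne_zero (hc : 1 < c.rank) (l : Fin n → k) :
    ∃ ξ : Fin n → k, ∑ j, ξ j * l j = 0 ∧ c.mulVec ξ ≠ 0 := by
  by_contra! H
  let L : (Fin n → k) →ₗ[k] k := Fintype.linearCombination k l
  have hle : LinearMap.ker L ≤ LinearMap.ker c.mulVecLin := fun ξ hξ =>
    H ξ (by simpa [L, Fintype.linearCombination_apply] using hξ)
  -- Dimension count: the kernel of a linear form has codimension at most 1, that of c has
  -- codimension equal to the rank.
  have h1 := Submodule.finrank_mono hle
  have h2 := LinearMap.finrank_range_add_finrank_ker L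
  have h3 := LinearMap.finrank_range_add_finrank_ker c.mulVecLin
  have h4 : Module.finrank k (LinearMap.range L) ≤ 1 := by
    simpa using Submodule.finrank_le (LinearMap.range L)
  rw [Matrix.rank] at hc
  omega

/-- From ∑ (l_j a) X_j = 0 one gets l_j a = b g_j for all j. For ξ orthogonal to l with cξ ≠ 0, the
form of cξ is ∑ ξ_j g_j, so b times it is (∑ ξ_j l_j) a = 0. Dividing by some l_j ≠ 0 gives a = b m
with m linear, so the degree i + 1 part of a comes from the degree i part of b, and induction on i
applies to b. -/
theorem eq_zero_of_mul_lin (hA : IsOneRelator c X) (hc : 1 < c.rank) {l : Fin n → k} (hl : l ≠ 0)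
    {a : A} (ha : a * lin X l = 0) : a = 0 := by
  obtain ⟨φ, hφ, hφ1⟩ := hA.exists_grading
  have step : ∀ l : Fin n → k, l ≠ 0 → ∀ a : A, a * lin X l = 0 →
      ∃ (b : A) (m m' : Fin n → k), m' ≠ 0 ∧ b * lin X m' = 0 ∧ a = b * lin X m := by
    intro l hl a ha
    obtain ⟨j, hj⟩ : ∃ j, l j ≠ 0 := by
      by_contra! H; exact hl (funext H)
    obtain ⟨b, hb⟩ := hA.exists_eq_mul_lin (a := fun j => l j • a) (by
      rw [← ha, lin, Finset.mul_sum]; simp)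
    obtain ⟨ξ, h0, h1⟩ := exists_mulVec_ne_zero hc l
    refine ⟨(l j)⁻¹ • b, fun i => c i j, _, h1, ?_, ?_⟩
    · rw [lin_sum_smul, smul_mul_assoc, Finset.mul_sum]
      simp only [mul_smul_comm, ← hb, smul_smul, ← Finset.sum_smul, h0, zero_smul, smul_zero]
    · rw [smul_mul_assoc, ← hb, smul_smul, inv_mul_cancel₀ hj, one_smul]
  have key : ∀ i : ℕ, ∀ l : Fin n → k, l ≠ 0 → ∀ a : A, a * lin X l = 0 → (φ a).coeff i = 0 := by
    intro i
    induction i with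
    | zero =>
      intro l hl a ha
      obtain ⟨b, m, m', -, -, rfl⟩ := step l hl a ha
      rw [map_mul, hφ, ← mul_assoc, Polynomial.mul_coeff_zero, Polynomial.coeff_X_zero, mul_zero]
    | succ i ih =>
      intro l hl a ha
      obtain ⟨b, m, m', hm', hb, rfl⟩ := step l hl a ha
      rw [map_mul, hφ, ← mul_assoc, Polynomial.coeff_mul_X, Polynomial.coeff_mul_C,
        ih m' hm' b hb, zero_mul]
  rw [← hφ1 a, show φ a = 0 from Polynomial.ext fun i => key i l hl a ha, Polynomial.eval_zero]

theorem eq_zero_of_lin_mul (hA : IsOneRelator c X) (hc : 1 < c.rank) {l : Fin n → k} (hl : l ≠ 0)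
    {a : A} (ha : lin X l * a = 0) : a = 0 := by
  refine MulOpposite.op_injective (hA.op.eq_zero_of_mul_lin (by rwa [Matrix.rank_transpose]) hl ?_)
  have := congrArg MulOpposite.op ha
  simpa [lin, Finset.op_sum] using this

theorem exists_col_ne_zero (hc : 1 < c.rank) : ∃ j, (fun i => c i j) ≠ 0 := by
  by_contra! H
  have : c = 0 := Matrix.ext fun i j => congrFun (H j) i
  rw [this, Matrix.rank_zero] at hc
  omega

end IsOneRelator

/-! ### A resolution of length two of an arbitrary module -/

section Resolution

variable {k : Type u} {A : Type w} [Field k] [Ring A] [Algebra k A] {n : ℕ}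
variable (N : Type w) [AddCommGroup N] [Module k N]

/-- The `A`-linear map `a ⊗ m ↦ a b ⊗ m`. -/
noncomputable def tensorMulRight (b : A) : A ⊗[k] N →ₗ[A] A ⊗[k] N :=
  TensorProduct.AlgebraTensorModule.map (LinearMap.toSpanSingleton A A b) LinearMap.id

variable {N} in
@[simp] theorem tensorMulRight_tmul (b a : A) (m : N) :
    tensorMulRight (k := k) N b (a ⊗ₜ m) = (a * b) ⊗ₜ m := rfl

variable [Module A N] [IsScalarTower k A N]

/-- The `A`-linear map `a ⊗ m ↦ a ⊗ b m`. -/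
noncomputable def tensorSMul (b : A) : A ⊗[k] N →ₗ[A] A ⊗[k] N :=
  TensorProduct.AlgebraTensorModule.map LinearMap.id (Algebra.lsmul k k N b)

variable {N}

@[simp] theorem tensorSMul_tmul (b a : A) (m : N) :
    tensorSMul (k := k) N b (a ⊗ₜ m) = a ⊗ₜ (b • m) := rfl

variable (N)

/-- The `A`-linear map `a ⊗ m ↦ a m`. -/
noncomputable def resD₀ : A ⊗[k] N →ₗ[A] N :=
  TensorProduct.AlgebraTensorModule.lift
    (LinearMap.toSpanSingleton A (N →ₗ[k] N) LinearMap.id)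

/-- The `A`-linear map `∑ (a ⊗ m) e_j ↦ a x_j ⊗ m - a ⊗ x_j m`. -/
noncomputable def resD₁ (X : Fin n → A) : (Fin n → A ⊗[k] N) →ₗ[A] A ⊗[k] N :=
  ∑ j, (tensorMulRight N (X j) - tensorSMul N (X j)).comp (LinearMap.proj j)

/-- The `A`-linear map `a ⊗ m ↦ ∑ (a g_j ⊗ m + a ⊗ h_j m) e_j`, where `g_j` and `h_j` are the
linear combinations of the generators given by the `j`-th column and the `j`-th row. -/
noncomputable def resD₂ (c : Matrix (Fin n) (Fin n) k) (X : Fin n → A) :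
    A ⊗[k] N →ₗ[A] (Fin n → A ⊗[k] N) :=
  LinearMap.pi fun j => tensorMulRight N (lin X fun i => c i j) + tensorSMul N (lin X (c j))

variable {N}

@[simp] theorem resD₀_tmul (a : A) (m : N) : resD₀ (k := k) N (a ⊗ₜ m) = a • m := rfl

theorem resD₁_apply (X : Fin n → A) (z : Fin n → A ⊗[k] N) :
    resD₁ N X z = ∑ j, (tensorMulRight N (X j) (z j) - tensorSMul N (X j) (z j)) := by
  simp [resD₁]

theorem resD₁_single (X : Fin n → A) (j : Fin n) (z : A ⊗[k] N) :
    resD₁ N X (Pi.single j z) = tensorMulRight N (X j) z - tensorSMul N (X j) z := by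
  rw [resD₁_apply, Finset.sum_eq_single j]
  · simp
  · intro b _ hb; simp [Pi.single_eq_of_ne hb]
  · simp

theorem resD₂_apply (c : Matrix (Fin n) (Fin n) k) (X : Fin n → A) (z : A ⊗[k] N) (j : Fin n) :
    resD₂ N c X z j =
      tensorMulRight N (lin X fun i => c i j) z + tensorSMul N (lin X (c j)) z := rfl

theorem resD₀_surjective : Function.Surjective (resD₀ (k := k) (A := A) N) := fun m =>
  ⟨1 ⊗ₜ m, by simp⟩

namespace IsOneRelator

variable {c : Matrix (Fin n) (Fin n) k} {X : Fin n → A}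

/-- Modulo the image of `resD₁`, letters move across the tensor sign, so z is congruent to 1 ⊗
`resD₀` z. -/
theorem exact_resD₁_resD₀ (hA : IsOneRelator c X) :
    Function.Exact (resD₁ (k := k) N X) (resD₀ N) := by
  have h1 : ∀ (a : A) (m : N),
      a ⊗ₜ[k] m - 1 ⊗ₜ (a • m) ∈ LinearMap.range (resD₁ (k := k) N X) := by
    intro a
    induction a using hA.induction_mul_left with
    | one => intro m; simp
    | add a b ha hb =>
      intro m
      have := add_mem (ha m) (hb m)
      rwa [sub_add_sub_comm, ← TensorProduct.add_tmul, ← TensorProduct.tmul_add, ← add_smul] at this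
    | smul r a ha =>
      intro m
      have := Submodule.smul_mem _ (algebraMap k A r) (ha m)
      rwa [algebraMap_smul, smul_sub, TensorProduct.smul_tmul', ← TensorProduct.tmul_smul,
        ← smul_assoc] at this
    | mul i a ha =>
      intro m
      have := add_mem (Submodule.smul_mem _ (X i) (ha m))
        (LinearMap.mem_range_self (resD₁ N X) (Pi.single i ((1 : A) ⊗ₜ (a • m))))
      rw [resD₁_single] at this
      simpa [smul_sub, TensorProduct.smul_tmul', mul_smul] using this
  have h2 : ∀ z : A ⊗[k] N, z - 1 ⊗ₜ (resD₀ N z) ∈ LinearMap.range (resD₁ (k := k) N X) := by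
    intro z
    induction z using TensorProduct.induction_on with
    | zero => simp
    | tmul a m => exact h1 a m
    | add a b ha hb =>
      have := add_mem ha hb
      rwa [sub_add_sub_comm, ← TensorProduct.tmul_add, ← map_add] at this
  intro z
  constructor
  · intro hz
    simpa [hz] using h2 z
  · rintro ⟨z, rfl⟩
    rw [resD₁_apply, map_sum]
    refine Finset.sum_eq_zero fun j _ => ?_
    induction z j using TensorProduct.induction_on with
    | zero => simp
    | tmul a m => simp [mul_smul]
    | add a b ha hb => rw [map_add, map_add, add_sub_add_comm, map_add, ha, hb, add_zero]

theorem resD₁_resD₂ (hA : IsOneRelator c X) (z : A ⊗[k] N) :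
    resD₁ N X (resD₂ N c X z) = 0 := by
  induction z using TensorProduct.induction_on with
  | zero => simp
  | add a b ha hb => rw [map_add, map_add, ha, hb, add_zero]
  | tmul a m =>
    have h1 : ∑ j, (a * lin X (fun i => c i j) * X j) ⊗ₜ[k] m = 0 := by
      simp only [mul_assoc, ← TensorProduct.sum_tmul, ← Finset.mul_sum, hA.rel_right]
      simp
    have h2 : ∑ j, a ⊗ₜ[k] (X j • lin X (c j) • m) = 0 := by
      simp only [← mul_smul, ← TensorProduct.tmul_sum, ← Finset.sum_smul, hA.rel_left]
      simp
    -- The mixed terms on both sides are ∑ c_ij a X_i ⊗ X_j m.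
    have h3 : ∑ j, (a * X j) ⊗ₜ[k] (lin X (c j) • m) =
        ∑ j, (a * lin X (fun i => c i j)) ⊗ₜ[k] (X j • m) := by
      simp only [lin, Finset.sum_smul, Finset.mul_sum, TensorProduct.tmul_sum,
        TensorProduct.sum_tmul]
      rw [Finset.sum_comm]
      simp only [mul_smul_comm, TensorProduct.smul_tmul, smul_assoc]
    rw [resD₁_apply]
    simp only [resD₂_apply, map_add, tensorMulRight_tmul, tensorSMul_tmul, Finset.sum_sub_distrib,
      Finset.sum_add_distrib, h1, h2, h3]
    abel

/-- The map induced by `resD₁` on the cokernel of `resD₂` has a left inverse σ. It comes from an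
extension of N by this cokernel, in which X_j sends (m, 0) to (X_j m, [(1 ⊗ m) e_j]). The relation
acts on (m, 0) by [`resD₂` (1 ⊗ m)] = 0, so A does act. -/
theorem exact_resD₂_resD₁ (hA : IsOneRelator c X) :
    Function.Exact (resD₂ (k := k) N c X) (resD₁ N X) := by
  let S := LinearMap.range (resD₂ (k := k) N c X)
  let y : Fin n → Module.End k (N × ((Fin n → A ⊗[k] N) ⧸ S)) := fun j =>
    ((Algebra.lsmul k k N (X j)).comp (LinearMap.fst k _ _)).prod
      ((Algebra.lsmul k k ((Fin n → A ⊗[k] N) ⧸ S) (X j)).comp (LinearMap.snd k _ _) +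
        (S.mkQ.restrictScalars k ∘ₗ LinearMap.single k (fun _ : Fin n => A ⊗[k] N) j ∘ₗ
          TensorProduct.mk k A N 1) ∘ₗ LinearMap.fst k _ _)
  have hy : ∀ j p, y j p =
      (X j • p.1, X j • p.2 + S.mkQ (Pi.single j ((1 : A) ⊗ₜ p.1))) := fun j p => rfl
  obtain ⟨φ, hφ⟩ := hA.lift _ y (by
    refine LinearMap.ext fun p => ?_
    simp only [LinearMap.sum_apply, LinearMap.smul_apply, Module.End.mul_apply, hy,
      LinearMap.zero_apply, Prod.smul_mk]
    refine Prod.ext ?_ ?_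
    · simp only [Prod.fst_sum, Prod.fst_zero]
      have := congrArg (· • p.1) hA.rel
      simpa [Finset.sum_smul, mul_smul] using this
    · have h1 : ∑ i, ∑ j, c i j • X i • X j • p.2 = 0 := by
        have := congrArg (· • p.2) hA.rel
        simpa [Finset.sum_smul, mul_smul] using this
      have h2 : ∑ i, ∑ j, c i j • (X i • (Pi.single j ((1 : A) ⊗ₜ[k] p.1) : Fin n → A ⊗[k] N) +
          Pi.single i ((1 : A) ⊗ₜ[k] (X j • p.1))) = resD₂ N c X (1 ⊗ₜ p.1) := by
        funext l
        simp only [Finset.sum_apply, Pi.smul_apply, Pi.add_apply, resD₂_apply, Pi.single_apply,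
          smul_add, Finset.sum_add_distrib, smul_ite, smul_zero, Finset.sum_ite_eq,
          Finset.mem_univ, if_true]
        rw [Finset.sum_comm (f := fun i j => if l = i then _ else _)]
        simp [lin, TensorProduct.sum_tmul, TensorProduct.tmul_sum, Finset.sum_smul,
          TensorProduct.smul_tmul']
      have h3 : S.mkQ (resD₂ N c X (1 ⊗ₜ p.1)) = 0 :=
        (Submodule.Quotient.mk_eq_zero S).2 ⟨_, rfl⟩
      rw [← h2] at h3
      simp only [Prod.snd_sum, Prod.snd_zero, smul_add, Finset.sum_add_distrib, h1, zero_add,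
        add_assoc]
      rw [← h3]
      simp only [map_sum, LinearMap.map_smul_of_tower, map_add, map_smul, smul_add,
        Finset.sum_add_distrib])
  have h1 : ∀ a q, φ a (0, q) = (0, a • q) := by
    intro a
    induction a using hA.induction_mul_left with
    | one => simp
    | add a b ha hb => intro p; simp [ha, hb, add_smul]
    | smul r a ha => intro p; simp [ha]
    | mul i a ha => intro p; simp [hφ, hy, ha, mul_smul]
  -- σ measures the failure of m ↦ (m, 0) to be A-linear.
  let σ : A ⊗[k] N →ₗ[k] (Fin n → A ⊗[k] N) ⧸ S := TensorProduct.lift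
    (LinearMap.mk₂ k (fun a m => (φ a (m, 0)).2) (fun a b m => by simp) (fun r a m => by simp)
      (fun a m m' => by
        rw [← Prod.snd_add, ← map_add, Prod.mk_add_mk, add_zero])
      (fun r a m => by
        rw [← Prod.smul_snd, ← map_smul, Prod.smul_mk, smul_zero]))
  have hσ : ∀ a m, σ (a ⊗ₜ m) = (φ a (m, 0)).2 := fun a m => rfl
  have h2 : ∀ j z, σ (resD₁ N X (Pi.single j z)) = S.mkQ (Pi.single j z) := by
    intro j z
    rw [resD₁_single]
    induction z using TensorProduct.induction_on with
    | zero => simp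
    | add a b ha hb =>
      rw [map_add, map_add, add_sub_add_comm, map_add, ha, hb, Pi.single_add, map_add]
    | tmul a m =>
      rw [tensorMulRight_tmul, tensorSMul_tmul, map_sub, hσ, hσ, ← Prod.snd_sub, map_mul,
        Module.End.mul_apply, hφ, hy, ← map_sub]
      simp only [Prod.mk_sub_mk, sub_self, smul_zero, zero_add, sub_zero, h1]
      rw [← map_smul, ← Pi.single_smul, TensorProduct.smul_tmul', smul_eq_mul, mul_one]
  intro z
  constructor
  · intro hz
    refine (Submodule.Quotient.mk_eq_zero S).1 ?_
    change S.mkQ z = 0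
    rw [← Finset.univ_sum_single z, map_sum]
    simp only [← h2]
    rw [← map_sum, ← map_sum, Finset.univ_sum_single, hz, map_zero]
  · rintro ⟨z, rfl⟩
    exact hA.resD₁_resD₂ z

/-- Leading terms: over a k-basis of N, take a coordinate of z of maximal degree d. The summand a ⊗
h_j m does not raise the degree of coordinates, so in degree d + 1 only the leading coefficient
times g_j survives. Choosing g_j ≠ 0 makes regularity kill that coefficient. -/
theorem resD₂_injective (hA : IsOneRelator c X) (hc : 1 < c.rank) :
    Function.Injective (resD₂ (k := k) N c X) := by
  classical
  obtain ⟨φ, hφ, hφ1⟩ := hA.exists_grading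
  let b := Module.Basis.ofVectorSpace k N
  let B := Algebra.TensorProduct.basis A b
  have hB : ∀ a m i, B.repr (a ⊗ₜ m) i = b.repr m i • a := fun a m i => by
    rw [Algebra.TensorProduct.basis_repr_tmul]
    simp [Algebra.smul_def, Algebra.commutes]
  have hmul : ∀ g z i, B.repr (tensorMulRight N g z) i = B.repr z i * g := by
    intro g z i
    induction z using TensorProduct.induction_on with
    | zero => simp
    | add a b ha hb => simp only [map_add, Finsupp.add_apply, ha, hb, add_mul]
    | tmul a m => simp only [tensorMulRight_tmul, hB, smul_mul_assoc]
  have hdeg : ∀ h (d : ℕ) z, (∀ i, (φ (B.repr z i)).natDegree ≤ d) →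
      ∀ i, (φ (B.repr (tensorSMul N h z) i)).natDegree ≤ d := by
    intro h d z hz i
    have e : tensorSMul N h z = ∑ l ∈ (B.repr z).support, B.repr z l ⊗ₜ (h • b l) := by
      conv_lhs => rw [← B.linearCombination_repr z, Finsupp.linearCombination_apply, Finsupp.sum]
      rw [map_sum]
      refine Finset.sum_congr rfl fun l _ => ?_
      rw [map_smul, Algebra.TensorProduct.basis_apply, tensorSMul_tmul, TensorProduct.smul_tmul',
        smul_eq_mul, mul_one]
    rw [e, map_sum, Finsupp.finsetSum_apply, map_sum]
    refine Polynomial.natDegree_sum_le_of_forall_le _ _ fun l _ => ?_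
    rw [hB, map_smul]
    exact (Polynomial.natDegree_smul_le _ _).trans (hz l)
  rw [← LinearMap.ker_eq_bot, LinearMap.ker_eq_bot']
  intro z hz
  by_contra hz0
  have hne : (B.repr z).support.Nonempty := by
    rw [Finsupp.support_nonempty_iff]
    simpa using hz0
  obtain ⟨i, hi, hmax⟩ := Finset.exists_max_image _ (fun i => (φ (B.repr z i)).natDegree) hne
  obtain ⟨j, hj⟩ := exists_col_ne_zero hc
  set d := (φ (B.repr z i)).natDegree with hd
  have hle : ∀ l, (φ (B.repr z l)).natDegree ≤ d := by
    intro l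
    by_cases hl : l ∈ (B.repr z).support
    · exact hmax l hl
    · rw [Finsupp.notMem_support_iff.1 hl]; simp
  have h1 := congrArg (fun y => (φ (B.repr y i)).coeff (d + 1)) (congrFun hz j)
  simp only [resD₂_apply, map_add, Finsupp.add_apply, Polynomial.coeff_add, hmul, map_mul, hφ,
    Pi.zero_apply, map_zero, Finsupp.zero_apply, Polynomial.coeff_zero] at h1
  rw [← mul_assoc, Polynomial.coeff_mul_X, Polynomial.coeff_mul_C,
    Polynomial.coeff_eq_zero_of_natDegree_lt (Nat.lt_succ_of_le (hdeg _ d z hle i)), add_zero] at h1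
  have h2 := hA.eq_zero_of_mul_lin hc hj h1
  rw [hd, Polynomial.coeff_natDegree, Polynomial.leadingCoeff_eq_zero] at h2
  refine Finsupp.mem_support_iff.1 hi ?_
  rw [← hφ1 (B.repr z i), h2, Polynomial.eval_zero]

end IsOneRelator

end Resolution

/-! ### Global dimension at most two -/

theorem hasProjectiveDimensionLT_three {A : Type w} [Ring A] {N P₀ P₁ P₂ : Type w}
    [AddCommGroup N] [AddCommGroup P₀] [AddCommGroup P₁] [AddCommGroup P₂]
    [Module A N] [Module A P₀] [Module A P₁] [Module A P₂]
    [Module.Projective A P₀] [Module.Projective A P₁] [Module.Projective A P₂]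
    {d₀ : P₀ →ₗ[A] N} {d₁ : P₁ →ₗ[A] P₀} {d₂ : P₂ →ₗ[A] P₁} (h₀ : Function.Surjective d₀)
    (h₁ : Function.Exact d₁ d₀) (h₂ : Function.Exact d₂ d₁) (h₃ : Function.Injective d₂) :
    HasProjectiveDimensionLT (ModuleCat.of A N) 3 := by
  have hp : ∀ (P : Type w) [AddCommGroup P] [Module A P] [Module.Projective A P] (m : ℕ),
      HasProjectiveDimensionLT (ModuleCat.of A P) (m + 1) := fun P _ _ _ m => by
    have := (IsProjective.iff_projective (R := A) P).1 inferInstance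
    exact hasProjectiveDimensionLT_of_ge _ 1 _ (by omega)
  let e : P₁ →ₗ[A] LinearMap.ker d₀ := d₁.codRestrict _ fun z => h₁.apply_apply_eq_zero z
  have he : Function.Surjective e := by
    rintro ⟨z, hz⟩
    obtain ⟨y, rfl⟩ := (h₁ z).1 hz
    exact ⟨y, rfl⟩
  have hd : Function.Exact d₂ e := fun z =>
    (Subtype.ext_iff.trans Iff.rfl : e z = 0 ↔ d₁ z = 0).trans (h₂ z)
  have hS : (ShortComplex.mk (ModuleCat.ofHom d₂) (ModuleCat.ofHom e)
      (by rw [← ModuleCat.ofHom_comp, hd.linearMap_comp_eq_zero]; rfl)).ShortExact :=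
    ModuleCat.shortComplex_shortExact _ hd h₃ he
  have hK := hS.hasProjectiveDimensionLT_X₃ 1 (hp P₂ 0) (hp P₁ 1)
  have hd' : Function.Exact (LinearMap.ker d₀).subtype d₀ :=
    LinearMap.exact_subtype_ker_map d₀
  have hT : (ShortComplex.mk (ModuleCat.ofHom (LinearMap.ker d₀).subtype) (ModuleCat.ofHom d₀)
      (by rw [← ModuleCat.ofHom_comp, hd'.linearMap_comp_eq_zero]; rfl)).ShortExact :=
    ModuleCat.shortComplex_shortExact _ hd' (Submodule.injective_subtype _) h₀
  exact hT.hasProjectiveDimensionLT_X₃ 2 hK (hp P₀ 2)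

theorem IsOneRelator.hasProjectiveDimensionLT {k : Type u} {A : Type w} [Field k] [Ring A]
    [Algebra k A] {n : ℕ} {c : Matrix (Fin n) (Fin n) k} {X : Fin n → A} (hA : IsOneRelator c X)
    (hc : 1 < c.rank) (N : ModuleCat.{w} A) :
    HasProjectiveDimensionLT N 3 := by
  -- An arbitrary A-module gets its k-structure by restriction of scalars, so that A ⊗ N makes
  -- sense.
  let : Module k N := Module.compHom N (algebraMap k A)
  have : IsScalarTower k A N := ⟨fun r a m => by
    rw [Algebra.smul_def, mul_smul]; rfl⟩
  exact hasProjectiveDimensionLT_three (N := N) (resD₀_surjective (k := k)) hA.exact_resD₁_resD₀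
    hA.exact_resD₂_resD₁ (hA.resD₂_injective hc)

/-! ### The groups `Ext(k, A)` -/

namespace IsOneRelator

variable {k : Type u} {A : Type w} [Field k] [Ring A] [Algebra k A] {n : ℕ}
  {c : Matrix (Fin n) (Fin n) k} {X : Fin n → A}

theorem exists_eq_sum_mul_right (hA : IsOneRelator c X) (ε : A →ₐ[k] k) (hε : ∀ i, ε (X i) = 0)
    (a : A) : ∃ z : Fin n → A, a = algebraMap k A (ε a) + ∑ j, z j * X j := by
  induction a using hA.induction_mul_left with
  | one => exact ⟨0, by simp⟩
  | add a b ha hb =>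
    obtain ⟨z, hz⟩ := ha
    obtain ⟨y, hy⟩ := hb
    refine ⟨z + y, ?_⟩
    conv_lhs => rw [hz, hy]
    simp only [map_add, Pi.add_apply, add_mul, Finset.sum_add_distrib]
    abel
  | smul r a ha =>
    obtain ⟨z, hz⟩ := ha
    refine ⟨r • z, ?_⟩
    conv_lhs => rw [hz]
    simp only [map_smul, Pi.smul_apply, smul_mul_assoc, ← Finset.smul_sum, smul_add]
    rw [smul_eq_mul, map_mul, Algebra.smul_def]
  | mul i a ha =>
    obtain ⟨z, hz⟩ := ha
    refine ⟨Pi.single i (algebraMap k A (ε a)) + fun j => X i * z j, ?_⟩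
    conv_lhs => rw [hz]
    simp [hε, mul_add, add_mul, Finset.sum_add_distrib, Finset.mul_sum, mul_assoc,
      Pi.single_apply, Algebra.commutes]

theorem exists_eq_sum_mul_left (hA : IsOneRelator c X) (ε : A →ₐ[k] k) (hε : ∀ i, ε (X i) = 0)
    (a : A) : ∃ z : Fin n → A, a = algebraMap k A (ε a) + ∑ j, X j * z j := by
  induction a using hA.induction_mul_left with
  | one => exact ⟨0, by simp⟩
  | add a b ha hb =>
    obtain ⟨z, hz⟩ := ha
    obtain ⟨y, hy⟩ := hb
    refine ⟨z + y, ?_⟩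
    conv_lhs => rw [hz, hy]
    simp only [map_add, Pi.add_apply, mul_add, Finset.sum_add_distrib]
    abel
  | smul r a ha =>
    obtain ⟨z, hz⟩ := ha
    refine ⟨r • z, ?_⟩
    conv_lhs => rw [hz]
    simp only [map_smul, Pi.smul_apply, mul_smul_comm, ← Finset.smul_sum, smul_add]
    rw [smul_eq_mul, map_mul, Algebra.smul_def]
  | mul i a ha => exact ⟨Pi.single i a, by simp [hε, Pi.single_apply]⟩

end IsOneRelator

section Trivial

variable {k : Type u} {A : Type w} [Field k] [Ring A] [Algebra k A] {n : ℕ}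

/-- The short complex `0 → A₊ → A → k → 0`. -/
abbrev augmentationComplex (ε : A →ₐ[k] k) : ShortComplex (ModuleCat.{w} A) :=
  LinearMap.shortComplexKer (Submodule.mkQ (RingHom.ker ε))

theorem augmentationComplex_shortExact (ε : A →ₐ[k] k) : (augmentationComplex ε).ShortExact :=
  LinearMap.shortExact_shortComplexKer (Submodule.mkQ_surjective _)

/-- The `A`-linear map `Aⁿ → A₊`, `(a_j) ↦ ∑ a_j x_j`. -/
noncomputable def toAugmentationIdeal (X : Fin n → A) (ε : A →ₐ[k] k) (hε : ∀ i, ε (X i) = 0) :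
    (Fin n → A) →ₗ[A] LinearMap.ker (Submodule.mkQ (RingHom.ker ε)) :=
  (Fintype.linearCombination A X).codRestrict _ fun z => by
    rw [LinearMap.mem_ker, Submodule.mkQ_apply, Submodule.Quotient.mk_eq_zero, RingHom.mem_ker,
      Fintype.linearCombination_apply]
    simp [hε]

theorem coe_toAugmentationIdeal (X : Fin n → A) (ε : A →ₐ[k] k) (hε : ∀ i, ε (X i) = 0)
    (z : Fin n → A) : (toAugmentationIdeal X ε hε z : A) = ∑ j, z j * X j := by
  simp [toAugmentationIdeal, Fintype.linearCombination_apply]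

/-- The `A`-linear map `A → Aⁿ`, `b ↦ (b g_j)`. -/
noncomputable def relationMap (c : Matrix (Fin n) (Fin n) k) (X : Fin n → A) :
    A →ₗ[A] (Fin n → A) :=
  LinearMap.toSpanSingleton A _ fun j => lin X fun i => c i j

namespace IsOneRelator

variable {c : Matrix (Fin n) (Fin n) k} {X : Fin n → A}

theorem relationMap_injective (hA : IsOneRelator c X) (hc : 1 < c.rank) :
    Function.Injective (relationMap c X) := by
  obtain ⟨j, hj⟩ := exists_col_ne_zero hc
  rw [← LinearMap.ker_eq_bot, LinearMap.ker_eq_bot']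
  exact fun b hb => hA.eq_zero_of_mul_lin hc hj (congrFun hb j)

theorem exact_relationMap (hA : IsOneRelator c X) (ε : A →ₐ[k] k) (hε : ∀ i, ε (X i) = 0) :
    Function.Exact (relationMap c X) (toAugmentationIdeal X ε hε) := by
  intro z
  rw [Subtype.ext_iff, coe_toAugmentationIdeal]
  constructor
  · intro hz
    obtain ⟨b, hb⟩ := hA.exists_eq_mul_lin hz
    exact ⟨b, funext fun j => (hb j).symm⟩
  · rintro ⟨b, rfl⟩
    have := congrArg (b * ·) hA.rel_right
    simpa [relationMap, Finset.mul_sum, mul_assoc] using this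

/-- The short complex `0 → A → Aⁿ → A₊ → 0`. -/
noncomputable abbrev syzygyComplex (hA : IsOneRelator c X) (ε : A →ₐ[k] k)
    (hε : ∀ i, ε (X i) = 0) : ShortComplex (ModuleCat.{w} A) :=
  ModuleCat.shortComplexOfCompEqZero (relationMap c X) (toAugmentationIdeal X ε hε)
    (hA.exact_relationMap ε hε).linearMap_comp_eq_zero

theorem syzygyComplex_shortExact (hA : IsOneRelator c X) (hc : 1 < c.rank) (ε : A →ₐ[k] k)
    (hε : ∀ i, ε (X i) = 0) : (hA.syzygyComplex ε hε).ShortExact := by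
  refine ModuleCat.shortComplex_shortExact _ (hA.exact_relationMap ε hε)
    (hA.relationMap_injective hc) ?_
  rintro ⟨a, ha⟩
  rw [LinearMap.mem_ker, Submodule.mkQ_apply, Submodule.Quotient.mk_eq_zero, RingHom.mem_ker] at ha
  obtain ⟨z, hz⟩ := hA.exists_eq_sum_mul_right ε hε a
  rw [ha, map_zero, zero_add] at hz
  exact ⟨z, Subtype.ext ((coe_toAugmentationIdeal X ε hε z).trans hz.symm)⟩

theorem rightMul_apply (a b : A) : (rightMul a).hom b = b * a := rfl

theorem eq_rightMul (φ : ModuleCat.of A A ⟶ ModuleCat.of A A) :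
    φ = rightMul (φ.hom (1 : A)) := by
  refine ModuleCat.hom_ext (LinearMap.ext_ring ?_)
  rw [rightMul_apply, one_mul]

theorem rightMul_add (a b : A) : rightMul (a + b) = rightMul a + rightMul b :=
  ModuleCat.hom_ext (LinearMap.ext_ring (mul_add (1 : A) a b))

theorem rightMul_comp (a b : A) : rightMul a ≫ rightMul b = rightMul (a * b) :=
  ModuleCat.hom_ext (LinearMap.ext_ring (mul_assoc (1 : A) a b))

/-- The class in `Ext²(k, A)` given by an element of `A`. -/
noncomputable def toExtTwo (hA : IsOneRelator c X) (hc : 1 < c.rank) (ε : A →ₐ[k] k)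
    (hε : ∀ i, ε (X i) = 0) :
    A →+ Abelian.Ext (trivialModule ε) (ModuleCat.of A A) 2 where
  toFun a := (augmentationComplex_shortExact ε).extClass.comp
    ((hA.syzygyComplex_shortExact hc ε hε).extClass.comp
      (Abelian.Ext.mk₀ (rightMul a)) (add_zero 1)) (by norm_num)
  map_zero' := by
    have : rightMul (0 : A) = 0 := ModuleCat.hom_ext (LinearMap.ext_ring (mul_zero _))
    rw [this, Abelian.Ext.mk₀_zero, Abelian.Ext.comp_zero, Abelian.Ext.comp_zero]
  map_add' a b := by
    rw [rightMul_add, Abelian.Ext.mk₀_add, Abelian.Ext.comp_add, Abelian.Ext.comp_add]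

theorem toExtTwo_apply (hA : IsOneRelator c X) (hc : 1 < c.rank) (ε : A →ₐ[k] k)
    (hε : ∀ i, ε (X i) = 0) (a : A) :
    hA.toExtTwo hc ε hε a = (augmentationComplex_shortExact ε).extClass.comp
      ((hA.syzygyComplex_shortExact hc ε hε).extClass.comp
        (Abelian.Ext.mk₀ (rightMul a)) (add_zero 1)) (by norm_num) := rfl

theorem toExtTwo_comp (hA : IsOneRelator c X) (hc : 1 < c.rank) (ε : A →ₐ[k] k)
    (hε : ∀ i, ε (X i) = 0) (a b : A) :
    (hA.toExtTwo hc ε hε a).comp (Abelian.Ext.mk₀ (rightMul b)) (add_zero 2) =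
      hA.toExtTwo hc ε hε (a * b) := by
  rw [toExtTwo_apply, toExtTwo_apply, Abelian.Ext.comp_assoc_of_third_deg_zero,
    Abelian.Ext.comp_assoc_of_third_deg_zero,
    Abelian.Ext.mk₀_comp_mk₀, rightMul_comp]

/-- Dimension shifting: both connecting maps are onto because higher Ext from A and from Aⁿ
vanishes, and every endomorphism of the left module A is a right multiplication. -/
theorem toExtTwo_surjective (hA : IsOneRelator c X) (hc : 1 < c.rank) (ε : A →ₐ[k] k)
    (hε : ∀ i, ε (X i) = 0) : Function.Surjective (hA.toExtTwo hc ε hε) := by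
  have hp : Projective (ModuleCat.of A A) :=
    (IsProjective.iff_projective (R := A) A).1 inferInstance
  have hp' : Projective (ModuleCat.of A (Fin n → A)) :=
    (IsProjective.iff_projective (R := A) (Fin n → A)).1 inferInstance
  intro e
  obtain ⟨e₁, rfl⟩ := Abelian.Ext.contravariant_sequence_exact₃
    (augmentationComplex_shortExact ε) _ e
    (Abelian.Ext.eq_zero_of_projective (P := ModuleCat.of A A) _) (n₀ := 1) (by norm_num)
  obtain ⟨e₀, rfl⟩ := Abelian.Ext.contravariant_sequence_exact₃
    (hA.syzygyComplex_shortExact hc ε hε) _ e₁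
    (Abelian.Ext.eq_zero_of_projective (P := ModuleCat.of A (Fin n → A)) _) (n₀ := 0) (by norm_num)
  obtain ⟨φ, rfl⟩ := (Abelian.Ext.mk₀_bijective _ _).2 e₀
  refine ⟨φ.hom (1 : A), ?_⟩
  conv_rhs => rw [eq_rightMul φ]
  rfl

/-- The class of a vanishes exactly when right multiplication by a extends along A → Aⁿ, b ↦ (b
g_j). An extension is determined by the images z_j of the basis vectors. Together with surjectivity
this identifies Ext²(k, A) with A / ∑ g_j A. -/
theorem toExtTwo_eq_zero_iff (hA : IsOneRelator c X) (hc : 1 < c.rank) (ε : A →ₐ[k] k)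
    (hε : ∀ i, ε (X i) = 0) (a : A) :
    hA.toExtTwo hc ε hε a = 0 ↔ ∃ z : Fin n → A, a = ∑ j, lin X (fun i => c i j) * z j := by
  have hp : Projective (ModuleCat.of A A) :=
    (IsProjective.iff_projective (R := A) A).1 inferInstance
  constructor
  · intro h
    obtain ⟨e₁, he₁⟩ := Abelian.Ext.contravariant_sequence_exact₁
      (augmentationComplex_shortExact ε) _ _ (by norm_num) h
    have : e₁ = 0 := Abelian.Ext.eq_zero_of_projective (P := ModuleCat.of A A) _
    rw [this, Abelian.Ext.comp_zero] at he₁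
    obtain ⟨e₀, he₀⟩ := Abelian.Ext.contravariant_sequence_exact₁
      (hA.syzygyComplex_shortExact hc ε hε) _ _ _ he₁.symm
    obtain ⟨ψ, rfl⟩ := (Abelian.Ext.mk₀_bijective _ _).2 e₀
    rw [Abelian.Ext.mk₀_comp_mk₀] at he₀
    have h1 := (Abelian.Ext.mk₀_bijective _ _).1 he₀
    have h2 : ψ.hom (relationMap c X 1) = 1 * a :=
      congrArg (fun φ : ModuleCat.of A A ⟶ ModuleCat.of A A => φ.hom (1 : A)) h1
    refine ⟨fun j => ψ.hom (Pi.single j (1 : A)), ?_⟩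
    rw [one_mul] at h2
    rw [← h2, ← Finset.univ_sum_single (relationMap c X 1), map_sum]
    refine Finset.sum_congr rfl fun j _ => ?_
    rw [← smul_eq_mul, ← map_smul, ← Pi.single_smul, smul_eq_mul, mul_one]
    simp [relationMap]
  · rintro ⟨z, hz⟩
    have h : rightMul a =
        (hA.syzygyComplex ε hε).f ≫ ModuleCat.ofHom (Fintype.linearCombination A z) := by
      refine ModuleCat.hom_ext (LinearMap.ext_ring ?_)
      rw [rightMul_apply, one_mul, hz]
      change _ = Fintype.linearCombination A z (relationMap c X 1)
      simp [relationMap, Fintype.linearCombination_apply]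
    rw [toExtTwo_apply, h, ← Abelian.Ext.mk₀_comp_mk₀, ShortComplex.ShortExact.extClass_comp_assoc,
      Abelian.Ext.comp_zero]

theorem toExtTwo_one_ne_zero (hA : IsOneRelator c X) (hc : 1 < c.rank) (ε : A →ₐ[k] k)
    (hε : ∀ i, ε (X i) = 0) : hA.toExtTwo hc ε hε 1 ≠ 0 := by
  intro h
  obtain ⟨z, hz⟩ := (hA.toExtTwo_eq_zero_iff hc ε hε 1).1 h
  have := congrArg ε hz
  simp [lin, hε] at this

/-! ### Global dimension two and the Gorenstein criterion. -/

theorem globalDimension_eq_two (hA : IsOneRelator c X) (hc : 1 < c.rank) (ε : A →ₐ[k] k)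
    (hε : ∀ i, ε (X i) = 0) : globalDimension A = 2 := by
  refine le_antisymm (iSup_le fun N => (projectiveDimension_le_iff N 2).2
    (hA.hasProjectiveDimensionLT hc N)) ?_
  refine le_trans ?_ (le_iSup _ (trivialModule ε))
  refine (projectiveDimension_ge_iff _ 2).2 fun h => hA.toExtTwo_one_ne_zero hc ε hε ?_
  exact Abelian.Ext.eq_zero_of_hasProjectiveDimensionLT _ 2 le_rfl

/-- The image of 1 under a morphism k → A is annihilated on the left by a nonzero linear form, which
is regular. -/
theorem subsingleton_ext_zero (hA : IsOneRelator c X) (hc : 1 < c.rank) (ε : A →ₐ[k] k)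
    (hε : ∀ i, ε (X i) = 0) :
    Subsingleton (Abelian.Ext (trivialModule ε) (ModuleCat.of A A) 0) := by
  refine subsingleton_of_forall_eq 0 fun e => ?_
  obtain ⟨φ, rfl⟩ := (Abelian.Ext.mk₀_bijective _ _).2 e
  obtain ⟨j, hj⟩ := exists_col_ne_zero hc
  suffices φ = 0 by rw [this, Abelian.Ext.mk₀_zero]
  refine ModuleCat.hom_ext (Submodule.linearMap_qext _ (LinearMap.ext_ring ?_))
  refine hA.eq_zero_of_lin_mul hc hj ?_
  rw [← smul_eq_mul]
  change lin X _ • φ.hom (Submodule.Quotient.mk (1 : A)) = 0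
  rw [← map_smul, ← Submodule.Quotient.mk_smul, (Submodule.Quotient.mk_eq_zero _).2, map_zero]
  simp [RingHom.mem_ker, lin, hε]

/-- A class in Ext¹ comes from φ : A₊ → A, and it dies as soon as φ extends to A. With z_j = φ(X_j),
the relation gives ∑ X_i (∑ c_ij z_j) = 0, hence ∑ c_ij z_j = h_i b. Inverting c yields z_j = X_j b,
so φ is the restriction of right multiplication by b. -/
theorem subsingleton_ext_one (hA : IsOneRelator c X) (hc : 1 < c.rank) (ε : A →ₐ[k] k)
    (hε : ∀ i, ε (X i) = 0) (hu : IsUnit c) :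
    Subsingleton (Abelian.Ext (trivialModule ε) (ModuleCat.of A A) 1) := by
  have hp : Projective (ModuleCat.of A A) :=
    (IsProjective.iff_projective (R := A) A).1 inferInstance
  refine subsingleton_of_forall_eq 0 fun e => ?_
  obtain ⟨e₀, rfl⟩ := Abelian.Ext.contravariant_sequence_exact₃
    (augmentationComplex_shortExact ε) _ e
    (Abelian.Ext.eq_zero_of_projective (P := ModuleCat.of A A) _) (n₀ := 0) (by norm_num)
  obtain ⟨φ, rfl⟩ := (Abelian.Ext.mk₀_bijective _ _).2 e₀
  let ψ : (Fin n → A) →ₗ[A] A := φ.hom ∘ₗ toAugmentationIdeal X ε hε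
  let z : Fin n → A := fun j => ψ (Pi.single j 1)
  have hψ : ∀ y, ψ y = ∑ j, y j * z j := by
    intro y
    conv_lhs => rw [← Finset.univ_sum_single y, map_sum]
    refine Finset.sum_congr rfl fun j _ => ?_
    rw [← smul_eq_mul, ← map_smul, ← Pi.single_smul, smul_eq_mul, mul_one]
  have h1 : ∑ j, lin X (fun i => c i j) * z j = 0 := by
    have := hψ (relationMap c X 1)
    simp only [relationMap, LinearMap.toSpanSingleton_apply, one_smul] at this
    rw [← this]
    change φ.hom (toAugmentationIdeal X ε hε _) = 0
    rw [((hA.exact_relationMap ε hε) _).2 ⟨1, by simp [relationMap]⟩, map_zero]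
  obtain ⟨b, hb⟩ := hA.exists_eq_lin_mul (a := fun i => ∑ j, c i j • z j) (by
    rw [← h1]
    simp only [lin, Finset.mul_sum, Finset.sum_mul]
    rw [Finset.sum_comm]
    simp only [mul_smul_comm, smul_mul_assoc])
  have h2 : ∀ j, z j = X j * b := by
    have hinv := Matrix.nonsing_inv_mul c ((Matrix.isUnit_iff_isUnit_det c).1 hu)
    have key : ∀ (y : Fin n → A) l, ∑ i, c⁻¹ l i • ∑ j, c i j • y j = y l := by
      intro y l
      simp only [Finset.smul_sum, smul_smul]
      rw [Finset.sum_comm]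
      simp only [← Finset.sum_smul, ← Matrix.mul_apply, hinv, Matrix.one_apply, ite_smul,
        one_smul, zero_smul, Finset.sum_ite_eq, Finset.mem_univ, if_true]
    intro l
    rw [← key z l, ← key X l, Finset.sum_mul]
    refine Finset.sum_congr rfl fun i _ => ?_
    rw [hb i, smul_mul_assoc]
    rfl
  have h3 : φ = (augmentationComplex ε).f ≫ rightMul b := by
    refine ModuleCat.hom_ext (LinearMap.ext fun y => ?_)
    obtain ⟨y, rfl⟩ := (hA.syzygyComplex_shortExact hc ε hε).moduleCat_surjective_g y
    refine (hψ y).trans ?_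
    change _ = (toAugmentationIdeal X ε hε y : A) * b
    rw [coe_toAugmentationIdeal, Finset.sum_mul]
    simp only [h2, mul_assoc]
  rw [h3, ← Abelian.Ext.mk₀_comp_mk₀, ShortComplex.ShortExact.extClass_comp_assoc]

/-- In degree one, only the constant term ε(z_j) of each z_j contributes, and linear forms determine
their coefficients. -/
theorem exists_lin_eq (hA : IsOneRelator c X) (ε : A →ₐ[k] k)
    (hε : ∀ i, ε (X i) = 0) {l : Fin n} {z : Fin n → A}
    (hz : X l = ∑ j, lin X (fun i => c i j) * z j) :
    ∃ ξ : Fin n → k, c.mulVec ξ = Pi.single l 1 := by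
  obtain ⟨φ, hφ, -⟩ := hA.exists_grading
  refine ⟨fun j => ε (z j), ?_⟩
  have hl : X l = lin X (Pi.single l (1 : k)) := by simp [lin, Pi.single_apply]
  have h0 : ∀ a, (φ a).coeff 0 = algebraMap k A (ε a) := by
    intro a
    obtain ⟨y, hy⟩ := hA.exists_eq_sum_mul_right ε hε a
    have hX : ∀ j, (φ (X j)) = Polynomial.C (X j) * Polynomial.X := fun j => by
      have := hφ (Pi.single j (1 : k))
      simpa [lin, Pi.single_apply] using this
    conv_lhs => rw [hy]
    simp [hX, Polynomial.finsetSum_coeff, Polynomial.mul_coeff_zero, ← mul_assoc,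
      Polynomial.algebraMap_apply]
  have h1 := congrArg (fun a => (φ a).coeff 1) hz
  simp only [hl, map_sum, map_mul, hφ, Polynomial.finsetSum_coeff, mul_assoc,
    Polynomial.coeff_C_mul, Polynomial.coeff_X_mul, Polynomial.coeff_X_one, mul_one] at h1
  simp only [h0] at h1
  have h2 : lin X (c.mulVec (fun j => ε (z j)) - Pi.single l 1) = 0 := by
    have e : ∀ p q : Fin n → k, lin X (p - q) = lin X p - lin X q := fun p q => by
      simp [lin, sub_smul]
    rw [e, lin_sum_smul, h1, sub_eq_zero]
    exact Finset.sum_congr rfl fun j _ => by rw [← Algebra.commutes, Algebra.smul_def]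
  exact sub_eq_zero.1 (hA.linearIndependent ε hε h2)

/-- If Ext² is k, then each X_l acts on it by zero. Applied to the class of 1, this puts X_l in ∑
g_j A, so every unit vector lies in the column space of c. Conversely, for invertible c the g_j span
the same space as the X_l, so ∑ g_j A = A₊. -/
theorem isASGorenstein_iff (hA : IsOneRelator c X) (hc : 1 < c.rank) (ε : A →ₐ[k] k)
    (hε : ∀ i, ε (X i) = 0) : IsASGorenstein ε ↔ IsUnit c := by
  have hgl := hA.globalDimension_eq_two hc ε hε
  constructor
  · rintro ⟨m, -, hm, -, φ, hφ⟩
    obtain rfl : m = 2 := by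
      rw [hgl] at hm
      exact_mod_cast hm.symm
    have h1 : ∀ l, ∃ ξ : Fin n → k, c.mulVec ξ = Pi.single l 1 := by
      intro l
      have h : hA.toExtTwo hc ε hε (X l) = 0 := by
        refine φ.injective ?_
        have := hφ (hA.toExtTwo hc ε hε 1) (X l)
        rwa [toExtTwo_comp, one_mul, hε, mul_zero, ← map_zero φ] at this
      obtain ⟨z, hz⟩ := (hA.toExtTwo_eq_zero_iff hc ε hε _).1 h
      exact hA.exists_lin_eq ε hε hz
    choose ξ hξ using h1
    refine (Matrix.isUnit_iff_isUnit_det c).2 (Matrix.isUnit_det_of_right_inverse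
      (B := Matrix.of fun i j => ξ j i) ?_)
    ext i j
    have := congrFun (hξ j) i
    rw [Matrix.mul_apply, Matrix.one_apply]
    rw [Pi.single_apply] at this
    exact this
  · intro hu
    have hker : ∀ a, hA.toExtTwo hc ε hε a = 0 ↔ ε a = 0 := by
      intro a
      rw [toExtTwo_eq_zero_iff]
      constructor
      · rintro ⟨z, rfl⟩
        simp [lin, hε]
      · intro ha
        obtain ⟨z, hz⟩ := hA.exists_eq_sum_mul_left ε hε a
        rw [ha, map_zero, zero_add] at hz
        have hinv := Matrix.mul_nonsing_inv c ((Matrix.isUnit_iff_isUnit_det c).1 hu)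
        have hX : ∀ l, X l = ∑ j, c⁻¹ j l • lin X fun i => c i j := by
          intro l
          rw [← lin_sum_smul X c fun j => c⁻¹ j l]
          have : (c.mulVec fun j => c⁻¹ j l) = fun i => (1 : Matrix (Fin n) (Fin n) k) i l := by
            rw [← hinv]; rfl
          rw [this]
          simp [lin, Matrix.one_apply]
        refine ⟨fun j => ∑ l, c⁻¹ j l • z l, ?_⟩
        rw [hz]
        simp only [Finset.mul_sum]
        rw [Finset.sum_comm]
        refine Finset.sum_congr rfl fun l _ => ?_
        conv_lhs => rw [hX l]
        rw [Finset.sum_mul]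
        simp only [smul_mul_assoc, mul_smul_comm]
    have hεs : Function.Surjective (ε : A →+ k) := fun r => ⟨algebraMap k A r, by simp⟩
    have hkk : (hA.toExtTwo hc ε hε).ker = (ε : A →+ k).ker := by
      ext a
      exact hker a
    let Φ := ((QuotientAddGroup.quotientKerEquivOfSurjective _
      (hA.toExtTwo_surjective hc ε hε)).symm.trans
      (QuotientAddGroup.quotientAddEquivOfEq hkk)).trans
      (QuotientAddGroup.quotientKerEquivOfSurjective _ hεs)
    have hΦ : ∀ a, Φ (hA.toExtTwo hc ε hε a) = ε a := by
      intro a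
      have : (QuotientAddGroup.quotientKerEquivOfSurjective _
          (hA.toExtTwo_surjective hc ε hε)).symm (hA.toExtTwo hc ε hε a) =
          QuotientAddGroup.mk a := by
        rw [AddEquiv.symm_apply_eq]; rfl
      simp only [Φ, AddEquiv.trans_apply, this]
      rfl
    refine ⟨2, by norm_num, hgl, fun i hi => ?_, Φ, fun e a => ?_⟩
    · obtain rfl | rfl | hi : i = 0 ∨ i = 1 ∨ 3 ≤ i := by omega
      · exact hA.subsingleton_ext_zero hc ε hε
      · exact hA.subsingleton_ext_one hc ε hε hu
      · have := hA.hasProjectiveDimensionLT hc (trivialModule ε)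
        exact HasProjectiveDimensionLT.subsingleton _ 3 i hi _
    · obtain ⟨b, rfl⟩ := hA.toExtTwo_surjective hc ε hε e
      rw [toExtTwo_comp, hΦ, hΦ, map_mul]

end IsOneRelator

end Trivial

/-! ### Quadratic algebras with one relation -/

section QuadAlg

variable {k : Type u} {V : Type v} [Field k] [AddCommGroup V] [Module k V] {n : ℕ}
  (x : Module.Basis (Fin n) k V) (f : V ⊗[k] V)

theorem sqMap_eq_sum :
    sqMap k V f =
      ∑ i, ∑ j, coeffMatrix x f i j • (TensorAlgebra.ι k (x i) * TensorAlgebra.ι k (x j)) := by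
  conv_lhs => rw [← sum_coeffMatrix x f]
  simp

theorem lin_generator (R : Submodule k (V ⊗[k] V)) (l : Fin n → k) :
    lin (fun i => generator R (x i)) l = generator R (∑ i, l i • x i) := by
  simp [lin]

theorem isOneRelator_quadAlg :
    IsOneRelator (coeffMatrix x f) (fun i => generator (Submodule.span k {f}) (x i)) where
  rel := by
    have hr : quadRel (Submodule.span k {f}) (sqMap k V f) 0 :=
      ⟨⟨f, Submodule.mem_span_singleton_self f, rfl⟩, rfl⟩
    have h : RingQuot.mkAlgHom k (quadRel (Submodule.span k {f})) (sqMap k V f) = 0 := by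
      rw [RingQuot.mkAlgHom_rel k hr, map_zero]
    rw [sqMap_eq_sum x] at h
    simpa [generator] using h
  lift B _ _ y hy := by
    let L := TensorAlgebra.lift k (x.constr k y)
    have hL : ∀ i, L (TensorAlgebra.ι k (x i)) = y i := fun i => by simp [L]
    have hrel : ∀ ⦃a b⦄, quadRel (Submodule.span k {f}) a b → L a = L b := by
      rintro a b ⟨⟨r, hr, rfl⟩, rfl⟩
      obtain ⟨s, rfl⟩ := Submodule.mem_span_singleton.1 hr
      rw [map_smul, map_smul, sqMap_eq_sum x, map_zero]
      simp only [map_sum, map_smul, map_mul, hL, hy, smul_zero]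
    refine ⟨RingQuot.liftAlgHom k ⟨L, hrel⟩, fun i => ?_⟩
    rw [← hL i]
    exact RingQuot.liftAlgHom_mkAlgHom_apply k _ hrel _
  adjoin := by
    refine eq_top_iff.2 fun a _ => ?_
    obtain ⟨t, rfl⟩ := RingQuot.mkAlgHom_surjective k (quadRel (Submodule.span k {f})) a
    induction t using TensorAlgebra.induction with
    | algebraMap r => rw [AlgHom.commutes]; exact Subalgebra.algebraMap_mem _ r
    | ι v =>
      have : RingQuot.mkAlgHom k (quadRel (Submodule.span k {f})) (TensorAlgebra.ι k v) =
          ∑ i, x.repr v i • generator (Submodule.span k {f}) (x i) := by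
        simp only [← map_smul, ← map_sum, x.sum_repr]
        rfl
      rw [this]
      exact sum_mem fun i _ => Subalgebra.smul_mem _
        (Algebra.subset_adjoin (Set.mem_range_self i)) _
    | mul a b ha hb => rw [map_mul]; exact mul_mem (ha trivial) (hb trivial)
    | add a b ha hb => rw [map_add]; exact add_mem (ha trivial) (hb trivial)

theorem augmentation_generator (R : Submodule k (V ⊗[k] V)) (v : V) :
    augmentation R (generator R v) = 0 := by
  refine (RingQuot.liftAlgHom_mkAlgHom_apply _ _ _ _).trans ?_
  simp [TensorAlgebra.algebraMapInv]

/-! ### The spaces `W_m` -/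

theorem sqMap_injective : Function.Injective (sqMap k V) := by
  have h : leftSplit k V ∘ₗ sqMap k V = (TensorAlgebra.ι k).lTensor V := by
    refine TensorProduct.ext' fun a b => ?_
    simp [leftSplit_ι_mul]
  have hinj : Function.Injective ((TensorAlgebra.ι k : V →ₗ[k] TensorAlgebra k V).lTensor V) :=
    Module.Flat.lTensor_preserves_injective_linearMap _ TensorAlgebra.ι_leftInverse.injective
  rw [← h, LinearMap.coe_comp] at hinj
  exact hinj.of_comp

/-- A tensor without constant term is recovered from its left partial derivatives. Since these send
W_{m+1} to W_m, vanishing of one W_m propagates upwards. -/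
theorem eq_sum_ι_mul_leftDeriv {S : Submodule k (TensorAlgebra k V)} {w : TensorAlgebra k V}
    (hw : w ∈ LinearMap.range (TensorAlgebra.ι k : V →ₗ[k] TensorAlgebra k V) * S) :
    w = ∑ i, TensorAlgebra.ι k (x i) * leftDeriv k V (x.coord i) w := by
  induction hw using Submodule.mul_induction_on' with
  | mem_mul_mem a ha t ht =>
    obtain ⟨v, rfl⟩ := ha
    have hd : ∀ i, leftDeriv k V (x.coord i) (TensorAlgebra.ι k v * t) = x.repr v i • t :=
      fun i => by simp [leftDeriv, leftSplit_ι_mul]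
    simp only [hd, mul_smul_comm, ← smul_mul_assoc, ← map_smul, ← Finset.sum_mul, ← map_sum,
      x.sum_repr]
  | add a _ b _ ha hb =>
    simp only [map_add, mul_add, Finset.sum_add_distrib]
    rw [← ha, ← hb]

theorem koszulW_succ_eq_bot (x : Module.Basis (Fin n) k V) {R : Submodule k (V ⊗[k] V)}
    {m : ℕ} (h : koszulW R m = ⊥) :
    koszulW R (m + 1) = ⊥ := by
  refine (Submodule.eq_bot_iff _).2 fun w hw => ?_
  have hw' := (Submodule.mem_inf.1 hw).1
  rw [tpow, pow_succ'] at hw'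
  rw [eq_sum_ι_mul_leftDeriv x hw']
  refine Finset.sum_eq_zero fun i _ => ?_
  have hi := leftDeriv_mem_koszulW R (x.coord i) hw
  rw [h, Submodule.mem_bot] at hi
  rw [hi, mul_zero]

theorem mem_koszulW_one {R : Submodule k (V ⊗[k] V)} {w : TensorAlgebra k V}
    (hw : w ∈ koszulW R 1) : ∃ v, w = TensorAlgebra.ι k v := by
  have h := (Submodule.mem_inf.1 hw).1
  rw [tpow, pow_one] at h
  obtain ⟨v, hv⟩ := h
  exact ⟨v, hv.symm⟩

variable {f} in
theorem mem_koszulW_two {w : TensorAlgebra k V} (hw : w ∈ koszulW (Submodule.span k {f}) 2) :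
    ∃ r : k, w = r • sqMap k V f := by
  have h := (Submodule.mem_inf.1 hw).2
  simp only [Submodule.mem_iInf] at h
  have h := h 0 0 rfl
  rw [tpow, pow_zero, one_mul, mul_one] at h
  obtain ⟨g, hg, rfl⟩ := h
  obtain ⟨r, rfl⟩ := Submodule.mem_span_singleton.1 hg
  exact ⟨r, map_smul _ _ _⟩

theorem sqMap_mem_koszulW_two : sqMap k V f ∈ koszulW (Submodule.span k {f}) 2 := by
  have hf : sqMap k V f ∈ (Submodule.span k {f}).map (sqMap k V) :=
    ⟨f, Submodule.mem_span_singleton_self f, rfl⟩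
  refine Submodule.mem_inf.2 ⟨?_, ?_⟩
  · rw [tpow, pow_two]
    induction f using TensorProduct.induction_on with
    | zero => simp
    | tmul a b => exact Submodule.mul_mem_mul ⟨a, rfl⟩ ⟨b, rfl⟩
    | add a b ha hb =>
      rw [map_add]
      exact add_mem (ha ⟨a, Submodule.mem_span_singleton_self a, rfl⟩)
        (hb ⟨b, Submodule.mem_span_singleton_self b, rfl⟩)
  · simp only [Submodule.mem_iInf]
    intro i j hij
    obtain ⟨rfl, rfl⟩ : i = 0 ∧ j = 0 := by omega
    rwa [tpow, pow_zero, one_mul, mul_one]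

theorem coeffMatrix_tmul (u v : V) :
    coeffMatrix x (u ⊗ₜ v) = Matrix.vecMulVec (x.repr u) (x.repr v) := by
  ext i j
  simp [coeffMatrix, Matrix.vecMulVec_apply, Module.Basis.tensorProduct_repr_tmul_apply, mul_comm]

theorem coeffMatrix_smul (r : k) : coeffMatrix x (r • f) = r • coeffMatrix x f := by
  ext i j
  simp [coeffMatrix]

variable {f}

/-- An element of R ⊗ V is f ⊗ v. Writing f_i for row i of f, its i-th left derivative f_i ⊗ v must
lie in W_2, so it equals r f. If r ≠ 0, then f would have rank at most 1. Hence f_i ⊗ v = 0 for all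
i, and v = 0 because f ≠ 0. -/
theorem koszulW_three_eq_bot (hf : 1 < (coeffMatrix x f).rank) :
    koszulW (Submodule.span k {f}) 3 = ⊥ := by
  refine (Submodule.eq_bot_iff _).2 fun w hw => ?_
  have key : ∀ w ∈ (Submodule.span k {f}).map (sqMap k V) *
      LinearMap.range (TensorAlgebra.ι k : V →ₗ[k] TensorAlgebra k V),
      ∃ v, w = sqMap k V f * TensorAlgebra.ι k v := by
    intro w h
    induction h using Submodule.mul_induction_on' with
    | mem_mul_mem a ha t ht =>
      obtain ⟨g, hg, rfl⟩ := ha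
      obtain ⟨r, rfl⟩ := Submodule.mem_span_singleton.1 hg
      obtain ⟨v, rfl⟩ := ht
      exact ⟨r • v, by simp⟩
    | add a _ b _ ha hb =>
      obtain ⟨v, rfl⟩ := ha
      obtain ⟨v', rfl⟩ := hb
      exact ⟨v + v', by rw [map_add, mul_add]⟩
  obtain ⟨v, rfl⟩ : ∃ v, w = sqMap k V f * TensorAlgebra.ι k v := by
    have h := (Submodule.mem_inf.1 hw).2
    simp only [Submodule.mem_iInf] at h
    have h := h 0 1 rfl
    rw [tpow, tpow, pow_zero, one_mul, pow_one] at h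
    exact key w h
  have hd : ∀ i, leftDeriv k V (x.coord i) (sqMap k V f * TensorAlgebra.ι k v) =
      sqMap k V ((∑ j, coeffMatrix x f i j • x j) ⊗ₜ v) := by
    intro i
    rw [sqMap_eq_sum x f]
    simp [leftDeriv, leftSplit_ι_mul, Finset.sum_mul, mul_assoc, Finsupp.single_apply]
  have hz : ∀ i l, coeffMatrix x f i l • v = 0 := by
    intro i l
    obtain ⟨r, hr⟩ := mem_koszulW_two (leftDeriv_mem_koszulW _ (x.coord i) hw)
    rw [hd, ← map_smul] at hr
    have h1 := congrArg (coeffMatrix x) (sqMap_injective hr)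
    rw [coeffMatrix_tmul, coeffMatrix_smul] at h1
    have hr0 : r = 0 := by
      by_contra hr0
      have h2 : coeffMatrix x f = Matrix.vecMulVec (r⁻¹ • (x.repr (∑ j, coeffMatrix x f i j • x j) :
          Fin n → k)) (x.repr v) := by
        rw [Matrix.smul_vecMulVec, h1, smul_smul, inv_mul_cancel₀ hr0, one_smul]
      rw [h2] at hf
      exact absurd hf (not_lt.2 (Matrix.rank_vecMulVec_le _ _))
    rw [hr0, zero_smul] at h1
    refine x.repr.injective (Finsupp.ext fun j => ?_)
    have := congrFun (congrFun h1 l) j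
    simpa [Matrix.vecMulVec_apply, Finsupp.single_apply] using this
  have hv : v = 0 := by
    by_contra hv
    have : coeffMatrix x f = 0 := Matrix.ext fun i l =>
      (smul_eq_zero.1 (hz i l)).resolve_right hv
    rw [this, Matrix.rank_zero] at hf
    omega
  rw [hv, map_zero, mul_zero]

theorem koszulW_eq_bot (hf : 1 < (coeffMatrix x f).rank) (m : ℕ) :
    koszulW (Submodule.span k {f}) (m + 3) = ⊥ := by
  induction m with
  | zero => exact koszulW_three_eq_bot x hf
  | succ m ih => exact koszulW_succ_eq_bot x ih

/-! ### Exactness of the Koszul complex -/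

theorem koszulX_eq_zero {R : Submodule k (V ⊗[k] V)} {m : ℕ} (h : koszulW R m = ⊥)
    (z : koszulX R m) : z = 0 := by
  obtain ⟨z, y, rfl⟩ := z
  refine Subtype.ext ?_
  change koszulIncl R m y = 0
  have : Subsingleton (koszulW R m) := by rw [h]; infer_instance
  rw [Subsingleton.elim y 0, map_zero]

theorem exists_eq_tmul_of_koszulX_two (z : koszulX (Submodule.span k {f}) 2) :
    ∃ a, (z : QuadAlg (Submodule.span k {f}) ⊗[k] TensorAlgebra k V) = a ⊗ₜ sqMap k V f := by
  obtain ⟨z, y, rfl⟩ := z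
  induction y using TensorProduct.induction_on with
  | zero => exact ⟨0, by simp⟩
  | tmul a w =>
    obtain ⟨r, hr⟩ := mem_koszulW_two w.2
    refine ⟨r • a, ?_⟩
    change a ⊗ₜ (w : TensorAlgebra k V) = _
    rw [hr, TensorProduct.smul_tmul]
  | add a b ha hb =>
    obtain ⟨a', ha⟩ := ha
    obtain ⟨b', hb⟩ := hb
    exact ⟨a' + b', by rw [TensorProduct.add_tmul, ← ha, ← hb]; exact map_add _ _ _⟩

theorem exists_eq_sum_of_koszulX_one {R : Submodule k (V ⊗[k] V)} (z : koszulX R 1) :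
    ∃ a : Fin n → QuadAlg R,
      (z : QuadAlg R ⊗[k] TensorAlgebra k V) = ∑ j, a j ⊗ₜ TensorAlgebra.ι k (x j) := by
  obtain ⟨z, y, rfl⟩ := z
  induction y using TensorProduct.induction_on with
  | zero => exact ⟨0, by simp⟩
  | tmul a w =>
    obtain ⟨v, hv⟩ := mem_koszulW_one w.2
    refine ⟨fun j => x.repr v j • a, ?_⟩
    change a ⊗ₜ (w : TensorAlgebra k V) = _
    rw [hv]
    conv_lhs => rw [← x.sum_repr v]
    simp only [map_sum, TensorProduct.tmul_sum, map_smul, TensorProduct.smul_tmul]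
  | add a b ha hb =>
    obtain ⟨a', ha⟩ := ha
    obtain ⟨b', hb⟩ := hb
    refine ⟨a' + b', ?_⟩
    simp only [Pi.add_apply, TensorProduct.add_tmul, Finset.sum_add_distrib]
    rw [← ha, ← hb]
    exact map_add _ _ _

theorem koszulMap_tmul_sqMap (R : Submodule k (V ⊗[k] V)) (a : QuadAlg R) (f : V ⊗[k] V) :
    koszulMap R (a ⊗ₜ sqMap k V f) =
      ∑ j, (a * lin (fun i => generator R (x i)) fun i => coeffMatrix x f i j) ⊗ₜ
        TensorAlgebra.ι k (x j) := by
  rw [sqMap_eq_sum x f, Finset.sum_comm]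
  simp only [TensorProduct.tmul_sum, map_sum, lin, Finset.mul_sum, TensorProduct.sum_tmul]
  refine Finset.sum_congr rfl fun j _ => Finset.sum_congr rfl fun i _ => ?_
  rw [← TensorProduct.smul_tmul, koszulMap_tmul_ι_mul, smul_mul_assoc, mul_smul_comm]

theorem eq_zero_of_sum_tmul_ι_eq_zero {B : Type w} [Ring B] [Algebra k B] {b : Fin n → B}
    (h : ∑ j, b j ⊗ₜ[k] TensorAlgebra.ι k (x j) = 0) (j : Fin n) : b j = 0 := by
  have := congrArg (TensorProduct.rid k B ∘
    (x.coord j ∘ₗ TensorAlgebra.ιInv).lTensor B) h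
  simpa [TensorAlgebra.ι_leftInverse _, Finsupp.single_apply] using this

theorem isKoszul_span_singleton (hf : 1 < (coeffMatrix x f).rank) :
    IsKoszul (Submodule.span k {f}) := by
  have hA := isOneRelator_quadAlg x f
  intro m z
  refine ⟨fun hz => ?_, ?_⟩
  swap
  · rintro ⟨y, rfl⟩
    exact koszulD_comp _ m y
  have hz' : koszulMap (Submodule.span k {f}) (z : _ ⊗[k] _) = 0 := congrArg Subtype.val hz
  obtain rfl | rfl | ⟨m, rfl⟩ : m = 0 ∨ m = 1 ∨ ∃ l, m = l + 2 := by
    obtain _ | _ | m := m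
    · exact Or.inl rfl
    · exact Or.inr (Or.inl rfl)
    · exact Or.inr (Or.inr ⟨m, rfl⟩)
  -- Degree 1: a cycle is a linear syzygy (a_j), so a_j = b g_j, and b ⊗ f is a preimage.
  · obtain ⟨a, ha⟩ := exists_eq_sum_of_koszulX_one x z
    have h1 : (∑ j, a j * generator (Submodule.span k {f}) (x j)) ⊗ₜ[k]
        (1 : TensorAlgebra k V) = 0 := by
      rw [← hz', ha, map_sum, TensorProduct.sum_tmul]
      refine Finset.sum_congr rfl fun j _ => ?_
      rw [← koszulMap_tmul_ι_mul, mul_one]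
    have h2 : ∑ j, a j * generator (Submodule.span k {f}) (x j) = 0 := by
      have := congrArg (TensorProduct.rid k _ ∘
        (TensorAlgebra.algebraMapInv : TensorAlgebra k V →ₐ[k] k).toLinearMap.lTensor _) h1
      simpa using this
    obtain ⟨b, hb⟩ := hA.exists_eq_mul_lin h2
    refine ⟨⟨b ⊗ₜ sqMap k V f, ⟨b ⊗ₜ ⟨_, sqMap_mem_koszulW_two f⟩, rfl⟩⟩, Subtype.ext ?_⟩
    change koszulMap _ (b ⊗ₜ sqMap k V f) = _
    rw [koszulMap_tmul_sqMap x, ha]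
    simp only [hb]
  -- Degree 2: a cycle a ⊗ f satisfies a g_j = 0 for all j, so a = 0 by regularity of a nonzero g_j.
  · obtain ⟨a, ha⟩ := exists_eq_tmul_of_koszulX_two z
    rw [ha, koszulMap_tmul_sqMap x] at hz'
    obtain ⟨j, hj⟩ := IsOneRelator.exists_col_ne_zero hf
    have h1 := hA.eq_zero_of_mul_lin hf hj (eq_zero_of_sum_tmul_ι_eq_zero x hz' j)
    refine ⟨0, ?_⟩
    rw [map_zero]
    exact Subtype.ext (by rw [ha, h1, TensorProduct.zero_tmul]; rfl)
  · refine ⟨0, ?_⟩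
    rw [map_zero]
    exact (koszulX_eq_zero (koszulW_eq_bot x hf m) z).symm

end QuadAlg

end QuadraticAlgebraOneRelation

/-! ### The theorem, by specialisation to the quadratic algebra of f. -/

theorem mainTheorem6 {k : Type u} {V : Type v} [Field k] [AddCommGroup V] [Module k V] {n : ℕ}
    (x : Module.Basis (Fin n) k V) (f : V ⊗[k] V) (hf : 1 < (coeffMatrix x f).rank) :
    (∀ v : V, v ≠ 0 → ∀ a : QuadAlg (Submodule.span k {f}),
      (generator (Submodule.span k {f}) v * a = 0 → a = 0) ∧
        (a * generator (Submodule.span k {f}) v = 0 → a = 0)) ∧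
    globalDimension (QuadAlg (Submodule.span k {f})) = 2 ∧
    IsKoszul (Submodule.span k {f}) ∧
    (IsASGorenstein (augmentation (Submodule.span k {f})) ↔ IsUnit (coeffMatrix x f)) := by
  have hA := isOneRelator_quadAlg x f
  have hε := fun i => augmentation_generator (Submodule.span k {f}) (x i)
  refine ⟨fun v hv a => ?_, hA.globalDimension_eq_two hf _ hε, isKoszul_span_singleton x hf,
    hA.isASGorenstein_iff hf _ hε⟩
  have hl : (x.repr v : Fin n → k) ≠ 0 := fun h => hv (x.repr.injective (by
    rw [map_zero]; exact DFunLike.coe_injective h))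
  have hv' : generator (Submodule.span k {f}) v =
      lin (fun i => generator (Submodule.span k {f}) (x i)) (x.repr v) := by
    rw [lin_generator, x.sum_repr]
  rw [hv']
  exact ⟨hA.eq_zero_of_lin_mul hf hl, hA.eq_zero_of_mul_lin hf hl⟩
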